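/- Let $(M,\tau)$ be a tracial W$^*$-probability space, i.e. a von Neumann algebra with a faithful normal trace state. For $X,Y\subseteq M$ let $X\vee Y$ be the algebra generated by $X\cup Y$; for a unital $*$-subalgebra $N\subseteq M$ let $E_N$ be the $\tau$-preserving conditional expectation of $M$ onto $W^*(N)$. For a subalgebra $S\subseteq N$, $N\otimes_S N$ is the algebraic tensor product over $S$ with its natural $N$-bimodule structure, and a derivation $D:N\to N\otimes_S N$ is a linear map with $D(ab)=a\cdot D(b)+D(a)\cdot b$. Let $B_1\subseteq B\subseteq M$ be unital W$^*$-subalgebras. Unital $*$-subalgebras $A,C\subseteq M$ are called $B$-free if every nonempty alternating product of elements of $(A\vee B)\cap\ker E_B$ and $(B\vee C)\cap\ker E_B$ lies in $\ker E_B$. Unital subalgebras $A_1,A_2\subseteq M$ are algebraically free with amalgamation over $S$ if $S\subseteq A_1\cap A_2$ and $A_1\vee A_2$ is the amalgamated free product of $A_1$ and $A_2$ over $S$. (1) Let $A,C\subseteq M$ be unital $*$-subalgebras which are $B$-free, and let $D:A\vee B\vee C\to (A\vee B\vee C)\otimes_{B_1}(A\vee B\vee C)$ be a derivation such that $D(B\vee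 C)=0$ and $D(A\vee B)\subseteq (A\vee B)\otimes_{B_1}(A\vee B)$ (meaning the image of this space in $(A\vee B\vee C)\otimes_{B_1}(A\vee B\vee C)$). Then $E_{A\vee B}(A\vee B\vee C)\subseteq A\vee B$ and $$(E_{A\vee B}\otimes_{B_1}E_{A\vee B})\circ D = D\circ E_{A\vee B}|_{A\vee B\vee C}.$$ (2) Let $A,C\subseteq M$ be unital $*$-subalgebras which are $B$-free and such that $A$ and $B\vee C$ are algebraically free with amalgamation over $B_1$. Write $\delta_{A_1:A_2;B_1}$ for the derivation $A_1\vee A_2\to (A_1\vee A_2)\otimes_{B_1}(A_1\vee A_2)$ determined by $a\mapsto a\otimes 1-1\otimes a$ for $a\in A_1$ and $a\mapsto 0$ for $a\in A_2$. Then $\delta_{A:B\vee C;B_1}$ and $\delta_{A:B;B_1}$ exist and are unique, $E_{A\vee B}(A\vee B\vee C)\subseteq A\vee B$, and $$(E_{A\vee B}\otimes_{B_1}E_{A\vee B})\circ\delta_{A:B\vee C;B_1}=\delta_{A:B;B_1}\circ E_{A\vee B}|_{A\vee B\vee C}.$$ (3) For a unitary $U \in M$ and a unital $*$-subalgebra $A\supseteq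 B_1$ write $A\langle U,U^*\rangle$ for the algebra generated by $A,U,U^*$, and $d_{U:A;B_1}$ for the derivation $A\langle U,U^*\rangle\to A\langle U,U^*\rangle\otimes_{B_1}A\langle U,U^*\rangle$ determined by $U\mapsto 1\otimes U$, $U^*\mapsto -U^*\otimes 1$, $a\mapsto 0$ $(a\in A)$. Let $U,V\in M$ be unitaries such that the algebras generated by $U,U^*$ and by $V,V^*$ are $B$-free, and such that $U$ is algebraically free from $B\langle V,V^*\rangle$ with amalgamation over $B_1$, i.e. $B_1\langle U,U^*\rangle$ and $B\langle V,V^*\rangle$ are algebraically free with amalgamation over $B_1$ and the derivation $d_{U:B_1;B_1}$ is well defined. Then $d_{UV:B;B_1}$ and $d_{U:B;B_1}$ exist and are unique, $E_{B\langle U,U^*\rangle}(B\langle U,V,U^*,V^*\rangle)\subseteq B\langle U,U^*\rangle$, and $$(E_{B\langle U,U^*\rangle}\otimes_{B_1}E_{B\langle U,U^*\rangle})\circ d_{UV:B;B_1}=d_{U:B;B_1}\circ E_{B\langle U,U^*\rangle}|_{B\langle UV,V^*U^*\rangle}.$$ -/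

import Mathlib

open scoped TensorProduct ComplexOrder InnerProductSpace

noncomputable section

namespace FreeCoalg

universe u

/-! ### Relative tensor products and derivations -/

section Algebraic

variable {R : Type u} [Ring R] [StarRing R] [Algebra ℂ R] [StarModule ℂ R]

/-- The relations `x b ⊗ y = x ⊗ b y`, `b ∈ S`, in `N ⊗ N` (tensor product over `ℂ`). -/
def balancedRel (S N : StarSubalgebra ℂ R) : Submodule ℂ (N ⊗[ℂ] N) :=
  Submodule.span ℂ {t | ∃ x y b : N, (b : R) ∈ S ∧ t = (x * b) ⊗ₜ[ℂ] y - x ⊗ₜ[ℂ] (b * y)}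

/-- The algebraic tensor product `N ⊗_S N` over the (noncommutative) subalgebra `S` of `N`. -/
abbrev AmalgTensor (S N : StarSubalgebra ℂ R) : Type u := (N ⊗[ℂ] N) ⧸ balancedRel S N

/-- The class of `x ⊗ y` in `N ⊗_S N`. -/
def tmk (S : StarSubalgebra ℂ R) {N : StarSubalgebra ℂ R} (x y : N) : AmalgTensor S N :=
  (balancedRel S N).mkQ (x ⊗ₜ[ℂ] y)

/-- The map `f ⊗_S f : N ⊗_S N → P ⊗_S P` induced by a linear map `f : N → P` of
`S`-bimodules. -/
def tensorMap {S N P : StarSubalgebra ℂ R} (hSP : S ≤ P) (f : N →ₗ[ℂ] P)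
    (hf : ∀ x b : N, (b : R) ∈ S →
      (f (x * b) : R) = (f x : R) * (b : R) ∧ (f (b * x) : R) = (b : R) * (f x : R)) :
    AmalgTensor S N →ₗ[ℂ] AmalgTensor S P :=
  Submodule.mapQ _ _ (TensorProduct.map f f) <| by
    rw [balancedRel, Submodule.span_le]
    rintro _ ⟨x, y, b, hb, rfl⟩
    refine Submodule.subset_span ⟨f x, f y, ⟨b, hSP hb⟩, hb, ?_⟩
    have h₁ : f (x * b) = f x * ⟨b, hSP hb⟩ := Subtype.ext (hf x b hb).1
    have h₂ : f (b * y) = ⟨b, hSP hb⟩ * f y := Subtype.ext (hf y b hb).2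
    simp [h₁, h₂]

/-- The canonical map `P ⊗_S P → N ⊗_S N` for `S ⊆ P ⊆ N`. -/
def tensorIncl {S P N : StarSubalgebra ℂ R} (hSP : S ≤ P) (hPN : P ≤ N) :
    AmalgTensor S P →ₗ[ℂ] AmalgTensor S N :=
  tensorMap (hSP.trans hPN) (StarSubalgebra.inclusion hPN).toAlgHom.toLinearMap
    (fun _ _ _ => ⟨rfl, rfl⟩)

/-- The left action `a · (x ⊗ y) = a x ⊗ y` of `N` on `N ⊗_S N`. -/
def lact (S : StarSubalgebra ℂ R) {N : StarSubalgebra ℂ R} (a : N) :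
    AmalgTensor S N →ₗ[ℂ] AmalgTensor S N :=
  Submodule.mapQ _ _ (LinearMap.rTensor N (LinearMap.mulLeft ℂ a)) <| by
    rw [balancedRel, Submodule.span_le]
    rintro _ ⟨x, y, b, hb, rfl⟩
    exact Submodule.subset_span ⟨a * x, y, b, hb, by simp [mul_assoc]⟩

/-- The right action `(x ⊗ y) · a = x ⊗ y a` of `N` on `N ⊗_S N`. -/
def ract (S : StarSubalgebra ℂ R) {N : StarSubalgebra ℂ R} (a : N) :
    AmalgTensor S N →ₗ[ℂ] AmalgTensor S N :=
  Submodule.mapQ _ _ (LinearMap.lTensor N (LinearMap.mulRight ℂ a)) <| by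
    rw [balancedRel, Submodule.span_le]
    rintro _ ⟨x, y, b, hb, rfl⟩
    exact Submodule.subset_span ⟨x, y * a, b, hb, by simp [mul_assoc]⟩

/-- `D : N → N ⊗_S N` is a derivation: `D(ab) = a · D(b) + D(a) · b`. -/
def IsDerivation {S N : StarSubalgebra ℂ R} (D : N →ₗ[ℂ] AmalgTensor S N) : Prop :=
  ∀ a b : N, D (a * b) = lact S a (D b) + ract S b (D a)

/-- `A₁` and `A₂` are algebraically free with amalgamation over `S`: they contain `S`, and
the algebra `A₁ ∨ A₂` they generate is the amalgamated free product of `A₁` and `A₂` over `S`,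
i.e. any two unital homomorphisms from `A₁` and `A₂` to a unital algebra `X` which agree on `S`
extend to a (necessarily unique) unital homomorphism from `A₁ ∨ A₂` to `X`. -/
def AlgFreeOver (S A₁ A₂ : StarSubalgebra ℂ R) : Prop :=
  S ≤ A₁ ∧ S ≤ A₂ ∧
  ∀ (X : Type u) [Ring X] [Algebra ℂ X] (f : A₁ →ₐ[ℂ] X) (g : A₂ →ₐ[ℂ] X),
    (∀ (s : R) (h₁ : s ∈ A₁) (h₂ : s ∈ A₂), s ∈ S → f ⟨s, h₁⟩ = g ⟨s, h₂⟩) →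
    ∃ h : ↥(A₁ ⊔ A₂) →ₐ[ℂ] X,
      (∀ a : A₁, h (StarSubalgebra.inclusion le_sup_left a) = f a) ∧
      (∀ a : A₂, h (StarSubalgebra.inclusion le_sup_right a) = g a)

/-- `δ` is the derivation `δ_{A₁:A₂;S} : A₁ ∨ A₂ → (A₁ ∨ A₂) ⊗_S (A₁ ∨ A₂)` determined by
`δ(a) = a ⊗ 1 - 1 ⊗ a` for `a ∈ A₁` and `δ(a) = 0` for `a ∈ A₂`. -/
def IsLiberationDer (S A₁ A₂ : StarSubalgebra ℂ R)
    (δ : ↥(A₁ ⊔ A₂) →ₗ[ℂ] AmalgTensor S (A₁ ⊔ A₂)) : Prop :=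
  IsDerivation δ ∧
  (∀ a : ↥(A₁ ⊔ A₂), (a : R) ∈ A₁ → δ a = tmk S a 1 - tmk S 1 a) ∧
  (∀ a : ↥(A₁ ⊔ A₂), (a : R) ∈ A₂ → δ a = 0)

/-- The algebra `A⟨U, U*⟩` generated by `A`, `U` and `U*`. -/
abbrev adjoinU (A : StarSubalgebra ℂ R) (U : R) : StarSubalgebra ℂ R :=
  A ⊔ StarAlgebra.adjoin ℂ {U}

/-- `d` is the derivation `d_{U:A;S} : A⟨U, U*⟩ → A⟨U, U*⟩ ⊗_S A⟨U, U*⟩` determined by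
`d(U) = 1 ⊗ U`, `d(U*) = - U* ⊗ 1` and `d(a) = 0` for `a ∈ A`. -/
def IsUnitaryDer (S A : StarSubalgebra ℂ R) (U : R)
    (d : ↥(adjoinU A U) →ₗ[ℂ] AmalgTensor S (adjoinU A U)) : Prop :=
  IsDerivation d ∧
  (∀ u : ↥(adjoinU A U), (u : R) = U → d u = tmk S 1 u ∧ d (star u) = - tmk S (star u) 1) ∧
  (∀ a : ↥(adjoinU A U), (a : R) ∈ A → d a = 0)

/-- The unitary `U` is algebraically free from `A` with amalgamation over `S`: the algebras
`S⟨U, U*⟩` and `A` are algebraically free with amalgamation over `S`, and `U` satisfies no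
algebraic relation over `S` which is incompatible with `d_{U:S;S}`, i.e. the derivation
`d_{U:S;S}` of `S⟨U, U*⟩` is well defined. (For `S = ℂ` this second condition says that the
powers of `U` are linearly independent.) -/
def UnitaryAlgFreeOver (S : StarSubalgebra ℂ R) (U : R) (A : StarSubalgebra ℂ R) : Prop :=
  AlgFreeOver S (adjoinU S U) A ∧ ∃ d, IsUnitaryDer S S U d

end Algebraic

/-! ### Tracial W*-probability spaces -/

section Tracial

variable {H : Type u} [NormedAddCommGroup H] [InnerProductSpace ℂ H] [CompleteSpace H]

/-- The `*`-algebra of elements of a von Neumann algebra `M`. -/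
abbrev Elt (M : VonNeumannAlgebra H) : Type u := ↥M.toStarSubalgebra

variable {M : VonNeumannAlgebra H}

/-- `τ` is a faithful normal trace state on `M`. Normality is ultraweak continuity. -/
structure IsTraceState (τ : Elt M →ₗ[ℂ] ℂ) : Prop where
  map_one : τ 1 = 1
  nonneg : ∀ x, 0 ≤ τ (star x * x)
  faithful : ∀ x, τ (star x * x) = 0 → x = 0
  trace : ∀ x y, τ (x * y) = τ (y * x)
  normal : ∃ ξ η : ℕ → H, Summable (fun n => ‖ξ n‖ ^ 2) ∧ Summable (fun n => ‖η n‖ ^ 2) ∧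
    ∀ x : Elt M, HasSum (fun n => ⟪η n, (x : H →L[ℂ] H) (ξ n)⟫_ℂ) (τ x)

/-- A unital `*`-subalgebra `N` of `M` is a W*-subalgebra, i.e. a von Neumann algebra on `H`. -/
def IsWStar (N : StarSubalgebra ℂ (Elt M)) : Prop :=
  ∃ N' : VonNeumannAlgebra H, N'.toStarSubalgebra = N.map M.toStarSubalgebra.subtype

/-- `W*(A)`, the bicommutant (in `B(H)`) of the unital `*`-subalgebra `A` of `M`. -/
def wStar (A : StarSubalgebra ℂ (Elt M)) : StarSubalgebra ℂ (Elt M) :=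
  (StarSubalgebra.centralizer ℂ (StarSubalgebra.centralizer ℂ
    (A.map M.toStarSubalgebra.subtype : Set (H →L[ℂ] H)) : Set (H →L[ℂ] H))).comap
    M.toStarSubalgebra.subtype

theorem le_wStar (A : StarSubalgebra ℂ (Elt M)) : A ≤ wStar A := by
  intro x hx
  rw [wStar, StarSubalgebra.mem_comap, StarSubalgebra.mem_centralizer_iff]
  intro g hg
  have hg' := hg
  rw [SetLike.mem_coe, StarSubalgebra.mem_centralizer_iff] at hg
  have hg2 := (StarSubalgebra.mem_centralizer_iff ℂ).mp (star_mem (SetLike.mem_coe.mp hg'))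
  have hxm : M.toStarSubalgebra.subtype x ∈
      (A.map M.toStarSubalgebra.subtype : Set (H →L[ℂ] H)) := ⟨x, hx, rfl⟩
  exact ⟨(hg _ hxm).1.symm, (hg2 _ hxm).1.symm⟩

/-- `E` is the `τ`-preserving conditional expectation of `M` onto `N`: an `N`-bimodular
projection of `M` onto `N` with `τ ∘ E = τ`. -/
structure IsCondExp (τ : Elt M →ₗ[ℂ] ℂ) (N : StarSubalgebra ℂ (Elt M))
    (E : Elt M →ₗ[ℂ] Elt M) : Prop where
  mem : ∀ x, E x ∈ N
  eq_self : ∀ n ∈ N, E n = n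
  mul_left : ∀ n ∈ N, ∀ x, E (n * x) = n * E x
  mul_right : ∀ n ∈ N, ∀ x, E (x * n) = E x * n
  trace : ∀ x, τ (E x) = τ x

theorem IsCondExp.unique {τ : Elt M →ₗ[ℂ] ℂ} (hτ : IsTraceState τ)
    {N : StarSubalgebra ℂ (Elt M)} {E F : Elt M →ₗ[ℂ] Elt M}
    (hE : IsCondExp τ N E) (hF : IsCondExp τ N F) : E = F := by
  ext1 x
  have hd : star (E x - F x) ∈ N := star_mem (sub_mem (hE.mem x) (hF.mem x))
  refine sub_eq_zero.mp (hτ.faithful _ ?_)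
  rw [mul_sub, map_sub, ← hE.mul_left _ hd, ← hF.mul_left _ hd, hE.trace, hF.trace, sub_self]

open Classical in
/-- The `τ`-preserving conditional expectation `E_N` of `M` onto the W*-subalgebra `N`. For a
faithful normal trace state `τ` it exists and is unique; `0` is a junk value otherwise. -/
def condExp (τ : Elt M →ₗ[ℂ] ℂ) (N : StarSubalgebra ℂ (Elt M)) : Elt M →ₗ[ℂ] Elt M :=
  if h : ∃ E, IsCondExp τ N E then h.choose else 0

theorem condExp_bimodule (τ : Elt M →ₗ[ℂ] ℂ) (N : StarSubalgebra ℂ (Elt M)) (x b : Elt M)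
    (hb : b ∈ N) :
    condExp τ N (x * b) = condExp τ N x * b ∧ condExp τ N (b * x) = b * condExp τ N x := by
  unfold condExp
  split_ifs with h
  · exact ⟨h.choose_spec.mul_right b hb x, h.choose_spec.mul_left b hb x⟩
  · simp

/-- `E_A`, the canonical trace preserving conditional expectation of `M` onto `W*(A)`. -/
abbrev canonExp (τ : Elt M →ₗ[ℂ] ℂ) (A : StarSubalgebra ℂ (Elt M)) : Elt M →ₗ[ℂ] Elt M :=
  condExp τ (wStar A)

/-- `A` and `C` are `B`-free in `(M, E_B)`: every nonempty alternating product of elements of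
`(A ∨ B) ∩ ker E_B` and `(B ∨ C) ∩ ker E_B` lies in `ker E_B`. -/
def BFree (τ : Elt M →ₗ[ℂ] ℂ) (B A C : StarSubalgebra ℂ (Elt M)) : Prop :=
  ∀ l : List (Bool × Elt M), l ≠ [] → l.IsChain (fun p q => p.1 ≠ q.1) →
    (∀ p ∈ l, p.2 ∈ (if p.1 then A ⊔ B else B ⊔ C) ∧ condExp τ B p.2 = 0) →
    condExp τ B (l.map Prod.snd).prod = 0

/-- If `S ⊆ P` and `E_P(N) ⊆ P`, the restriction of `E_P ⊗_S E_P` to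
`N ⊗_S N → P ⊗_S P`. -/
def expTensor (τ : Elt M →ₗ[ℂ] ℂ) {S N P : StarSubalgebra ℂ (Elt M)} (hSP : S ≤ P)
    (hE : ∀ x ∈ N, canonExp τ P x ∈ P) : AmalgTensor S N →ₗ[ℂ] AmalgTensor S P :=
  tensorMap hSP
    (((canonExp τ P).comp N.subtype.toAlgHom.toLinearMap).codRestrict
      P.toSubalgebra.toSubmodule (fun x => hE x x.2) : N →ₗ[ℂ] P)
    (fun x b hb => condExp_bimodule τ (wStar P) x b (le_wStar P (hSP hb)))

end Tracial

end FreeCoalg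

end

open FreeCoalg

open scoped TensorProduct ComplexOrder InnerProductSpace

noncomputable section

namespace FreeCoalg

universe u

/-! ### Diagonal amplifications and bicommutants -/

section Amplification

variable {H : Type u} [NormedAddCommGroup H] [InnerProductSpace ℂ H] [CompleteSpace H]
variable {ι : Type*}

set_option linter.unusedSectionVars false

/-! Put `P = A ∨ B` and `Q = B ∨ C`. Centering letters by `E_B` shows that `P ∨ Q` is spanned by `P`
and by the alternating centered words with at least one letter in `Q` (`IsBimodProj.mem_span_word`).
On `P` the expectation `E_P` is the identity and `D` takes values in the image of `P ⊗ P`, so the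
identity is clear there. It remains to see that both sides vanish on a word `w` with a letter in
`Q`.

For `y ∈ P`, freeness gives `E_B(w y) = 0`, hence `τ(w y) = 0`. Normality of `τ` extends this to `y
∈ W*(P)`, so `E_P(w) = 0` (`IsTraceState.canonExp_word`). The Leibniz rule writes `D(w)` as a sum of
terms `u · D(a) · v` over the factorisations `w = u a v` at a letter `a`. Letters in `Q` contribute
zero. For a letter in `P`, `D(a)` comes from `P ⊗ P`, and `E_P ⊗ E_P` sends `u p ⊗ q v` to `E_P(u) p
⊗ q E_P(v)`. This is zero because `u` or `v` contains the letter in `Q`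
(`IsDerivation.tensorMap_word`).

For the concrete derivations, existence comes from the universal property of the amalgamated free
product, applied to upper triangular representations (`AlgFreeOver.exists_derivation`), and
uniqueness from the Leibniz rule on generators. Restricting a derivation to a subalgebra requires `P
⊗ P → N ⊗ N` to be injective. This holds over a W*-subalgebra `S`, because the projection onto the
kernel of a Gram matrix `E_S(x_i* x_j)` has entries in `S` (`IsTraceState.tensorIncl_injective`). In
the unitary case both derivations are restrictions of one derivation with `U ↦ 1 ⊗ U` that kills
`B⟨V, V*⟩`.

Conditional expectations are constructed from the trace by compactness and Hahn-Banach separation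
(`IsTraceState.exists_isCondExp`). -/

/-- The diagonal action of an operator on `ℓ²(ι, H)`. -/
def ampl (ι : Type*) (T : H →L[ℂ] H) :
    lp (fun _ : ι => H) 2 →L[ℂ] lp (fun _ : ι => H) 2 :=
  lp.mapCLM 2 (fun _ => T) (norm_nonneg T) (fun _ => le_rfl)

@[simp]
theorem ampl_apply (T : H →L[ℂ] H) (f : lp (fun _ : ι => H) 2) (i : ι) :
    ampl ι T f i = T (f i) := rfl

theorem inner_ampl_left (T : H →L[ℂ] H) (f g : lp (fun _ : ι => H) 2) :
    ⟪ampl ι T f, g⟫_ℂ = ⟪f, ampl ι (star T) g⟫_ℂ := by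
  rw [lp.inner_eq_tsum, lp.inner_eq_tsum]
  refine tsum_congr fun i => ?_
  rw [ampl_apply, ampl_apply, ContinuousLinearMap.star_eq_adjoint,
    ContinuousLinearMap.adjoint_inner_right]

theorem starProjection_ampl (K : Submodule ℂ (lp (fun _ : ι => H) 2)) [K.HasOrthogonalProjection]
    (T : H →L[ℂ] H) (h₁ : ∀ v ∈ K, ampl ι T v ∈ K) (h₂ : ∀ v ∈ K, ampl ι (star T) v ∈ K)
    (v : lp (fun _ : ι => H) 2) :
    K.starProjection (ampl ι T v) = ampl ι T (K.starProjection v) := by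
  refine Submodule.eq_starProjection_of_mem_of_inner_eq_zero
    (h₁ _ (Submodule.starProjection_apply_mem K v)) fun w hw => ?_
  rw [← map_sub, inner_ampl_left]
  exact Submodule.starProjection_inner_eq_zero v _ (h₂ w hw)

/-- The matrix entries of an operator on `ℓ²(ι, H)`. -/
def entry [DecidableEq ι] (p : lp (fun _ : ι => H) 2 →L[ℂ] lp (fun _ : ι => H) 2)
    (i j : ι) : H →L[ℂ] H :=
  (lp.evalCLM ℂ (fun _ : ι => H) 2 i).comp
    (p.comp (lp.singleContinuousLinearMap ℂ (fun _ : ι => H) 2 j))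

theorem entry_apply [DecidableEq ι] (p : lp (fun _ : ι => H) 2 →L[ℂ] lp (fun _ : ι => H) 2)
    (i j : ι) (h : H) :
    entry p i j h = p (lp.single 2 j h) i := rfl

theorem ampl_single [DecidableEq ι] (T : H →L[ℂ] H) (j : ι) (h : H) :
    ampl ι T (lp.single 2 j h) = lp.single 2 j (T h) := by
  ext i
  rw [ampl_apply]
  by_cases hij : i = j
  · subst hij; simp
  · simp [hij]

theorem commute_entry [DecidableEq ι]
    (p : lp (fun _ : ι => H) 2 →L[ℂ] lp (fun _ : ι => H) 2) (T : H →L[ℂ] H)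
    (hp : ∀ v, p (ampl ι T v) = ampl ι T (p v)) (i j : ι) : T * entry p i j = entry p i j * T := by
  ext h
  simp only [mul_apply_eq_comp, entry_apply]
  rw [← ampl_single, hp, ampl_apply]

theorem commute_of_entry [DecidableEq ι]
    (p : lp (fun _ : ι => H) 2 →L[ℂ] lp (fun _ : ι => H) 2) (T : H →L[ℂ] H)
    (hp : ∀ i j, entry p i j * T = T * entry p i j) (v) : p (ampl ι T v) = ampl ι T (p v) := by
  have : p.comp (ampl ι T) = (ampl ι T).comp p := by
    refine lp.ext_continuousLinearMap (by simp) fun j => ?_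
    ext h i
    have := congrArg (fun S => S h) (hp i j)
    simp only [mul_apply_eq_comp, entry_apply] at this
    simp only [ContinuousLinearMap.comp_apply, lp.singleContinuousLinearMap_apply, ampl_single,
      ampl_apply]
    convert this
  exact congrArg (fun S => S v) this

/-- The elements of the bicommutant of a `*`-subalgebra are, on a given vector of `ℓ²(ι, H)`,
limits of elements of the subalgebra. -/
theorem ampl_mem_closure (A : StarSubalgebra ℂ (H →L[ℂ] H)) (x : H →L[ℂ] H)
    (hx : ∀ s : H →L[ℂ] H, (∀ a ∈ A, a * s = s * a) → s * x = x * s)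
    (ξ : lp (fun _ : ι => H) 2) :
    ampl ι x ξ ∈ closure {v | ∃ a ∈ A, v = ampl ι a ξ} := by
  classical
  let K₀ : Submodule ℂ (lp (fun _ : ι => H) 2) :=
    { carrier := {v | ∃ a ∈ A, v = ampl ι a ξ}
      add_mem' := by
        rintro _ _ ⟨a, ha, rfl⟩ ⟨b, hb, rfl⟩
        exact ⟨a + b, add_mem ha hb, by ext; simp⟩
      zero_mem' := ⟨0, zero_mem A, by ext; simp⟩
      smul_mem' := by
        rintro c _ ⟨a, ha, rfl⟩
        exact ⟨c • a, A.smul_mem ha c, by ext; simp⟩ }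
  -- `K` is the closure of `A ξ`. It reduces `A`, so the entries of its projection commute with `A`
  -- and therefore with `x`. The projection then commutes with the amplification of `x`, which
  -- preserves `K`, and `ξ ∈ K` because `1 ∈ A`.
  let K := K₀.topologicalClosure
  have : CompleteSpace K := K₀.isClosed_topologicalClosure.completeSpace_coe
  have hinv : ∀ a ∈ A, ∀ v ∈ K, ampl ι a v ∈ K := fun a ha v hv =>
    map_mem_closure (ampl ι a).continuous hv (by
      rintro _ ⟨b, hb, rfl⟩
      exact ⟨a * b, mul_mem ha hb, by ext; simp⟩)
  have hp : ∀ v, K.starProjection (ampl ι x v) = ampl ι x (K.starProjection v) :=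
    commute_of_entry _ _ fun i j => hx _ fun a ha => commute_entry _ _
      (starProjection_ampl K a (hinv a ha) (hinv _ (star_mem ha))) i j
  have hξ : ξ ∈ K := K₀.le_topologicalClosure ⟨1, one_mem A, by ext; simp⟩
  have h := hp ξ
  rw [Submodule.starProjection_eq_self_iff.mpr hξ] at h
  exact Submodule.starProjection_eq_self_iff.mp h

/-- The projection onto the kernel of a matrix over a bicommutant has entries in the
bicommutant. -/
theorem exists_kernel_matrix [Fintype ι] (A : StarSubalgebra ℂ (H →L[ℂ] H))
    (G : ι → ι → H →L[ℂ] H)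
    (hG : ∀ i j, ∀ s : H →L[ℂ] H, (∀ a ∈ A, a * s = s * a) → s * G i j = G i j * s) :
    ∃ p : ι → ι → H →L[ℂ] H,
      (∀ i j, ∀ s : H →L[ℂ] H, (∀ a ∈ A, a * s = s * a) → s * p i j = p i j * s) ∧
      (∀ i k, ∑ j, G i j * p j k = 0) ∧
      ∀ y : ι → H →L[ℂ] H, (∀ i, ∑ j, G i j * y j = 0) → ∀ i, ∑ j, p i j * y j = y i := by
  classical
  -- `K` is the kernel of `G` acting on `H^ι`. The commutant of `A`, which is closed under adjoints,
  -- preserves `K`, so the entries of the projection lie in the bicommutant. A column `y` with `G y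
  -- = 0` takes its values in `K` and is fixed by the projection.
  let K : Submodule ℂ (lp (fun _ : ι => H) 2) := ⨅ i,
    LinearMap.ker (∑ j, (G i j).comp (lp.evalCLM ℂ (fun _ : ι => H) 2 j)).toLinearMap
  have hmem : ∀ v, v ∈ K ↔ ∀ i, ∑ j, G i j (v j) = 0 := by
    intro v
    simp only [K, Submodule.mem_iInf, LinearMap.mem_ker]
    refine forall_congr' fun i => ?_
    simp [lp.evalCLM]
  have hcl : IsClosed (K : Set (lp (fun _ : ι => H) 2)) := by
    simp only [K, Submodule.coe_iInf]
    exact isClosed_iInter fun i => ContinuousLinearMap.isClosed_ker _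
  have : CompleteSpace K := hcl.completeSpace_coe
  have hinv : ∀ s : H →L[ℂ] H, (∀ a ∈ A, a * s = s * a) → ∀ v ∈ K, ampl ι s v ∈ K := by
    intro s hs v hv
    rw [hmem] at hv ⊢
    intro i
    have := congrArg s (hv i)
    rw [map_sum, map_zero] at this
    rw [← this]
    refine Finset.sum_congr rfl fun j _ => ?_
    exact (congrArg (fun S => S (v j)) (hG i j s hs)).symm
  have hstar : ∀ s : H →L[ℂ] H, (∀ a ∈ A, a * s = s * a) → ∀ a ∈ A, a * star s = star s * a := by
    intro s hs a ha
    have := congrArg star (hs _ (star_mem ha))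
    simpa using this.symm
  refine ⟨entry K.starProjection, fun i j s hs => commute_entry _ _
    (starProjection_ampl K s (hinv s hs) (hinv _ (hstar s hs))) i j, ?_⟩
  refine ⟨fun i k => ?_, fun y hy i => ?_⟩
  · ext h
    have := (hmem _).mp (Submodule.starProjection_apply_mem K (lp.single 2 k h)) i
    simpa [entry_apply] using this
  · ext h
    let v : lp (fun _ : ι => H) 2 := ∑ j, lp.single 2 j (y j h)
    have hv : ∀ i, v i = y i h := by
      intro i
      simp only [v, lp.coeFn_sum, Finset.sum_apply]
      rw [Finset.sum_eq_single i]
      · simp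
      · intro j _ hj
        simp [hj.symm]
      · simp
    have hvK : v ∈ K := by
      rw [hmem]
      intro i
      have := congrArg (fun S => S h) (hy i)
      simpa [hv] using this
    have h1 := congrArg (fun w : lp (fun _ : ι => H) 2 => w i)
      (Submodule.starProjection_eq_self_iff.mpr hvK)
    simp only [hv] at h1
    rw [← h1]
    simp only [v, map_sum, lp.coeFn_sum, Finset.sum_apply]
    simp [entry_apply]

end Amplification

/-! ### Existence of conditional expectations -/

section Operators

variable {H : Type u} [NormedAddCommGroup H] [InnerProductSpace ℂ H] [CompleteSpace H]

set_option linter.unusedSectionVars false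

theorem operator_nonneg_iff (T : H →L[ℂ] H) : 0 ≤ T ↔ ∀ v, 0 ≤ ⟪v, T v⟫_ℂ := by
  rw [ContinuousLinearMap.nonneg_iff_isPositive]
  refine ⟨fun h v => h.inner_nonneg_right v, fun h => ?_⟩
  rw [ContinuousLinearMap.isPositive_iff_complex]
  intro v
  have hv := h v
  have h0 : 0 ≤ ⟪T v, v⟫_ℂ := by
    rw [← inner_conj_symm]
    simpa using star_nonneg_iff.mpr hv
  have h1 := Complex.nonneg_iff.mp h0
  exact ⟨Complex.ext (by simp) (by simpa using h1.2), h1.1⟩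

/-- Norm bounded families of operators have weak limits along ultrafilters. -/
theorem exists_weak_limit {α : Type*} (F : Ultrafilter α) (T : α → H →L[ℂ] H) (C : ℝ)
    (hT : ∀ᶠ i in (F : Filter α), ‖T i‖ ≤ C) :
    ∃ T₀ : H →L[ℂ] H, ∀ u v,
      Filter.Tendsto (fun i => ⟪u, T i v⟫_ℂ) F (nhds ⟪u, T₀ v⟫_ℂ) := by
  have hbd : ∀ u v, ∀ᶠ i in (F : Filter α), ‖⟪T i u, v⟫_ℂ‖ ≤ C * ‖u‖ * ‖v‖ := by
    intro u v
    filter_upwards [hT] with i hi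
    refine (norm_inner_le_norm _ _).trans ?_
    gcongr
    exact (T i).le_of_opNorm_le hi u
  have hlim : ∀ u v, ∃ z : ℂ, Filter.Tendsto (fun i => ⟪T i u, v⟫_ℂ) F (nhds z) := by
    intro u v
    obtain ⟨z, -, hz⟩ := (isCompact_closedBall (0 : ℂ) (C * ‖u‖ * ‖v‖)).ultrafilter_le_nhds
      (F.map fun i => ⟪T i u, v⟫_ℂ) (by
        rw [Filter.le_principal_iff]
        exact (hbd u v).mono fun i hi => by simpa using hi)
    exact ⟨z, hz⟩
  choose b hb using hlim
  have huniq : ∀ {f : α → ℂ} {z w : ℂ}, Filter.Tendsto f F (nhds z) →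
      Filter.Tendsto f F (nhds w) → z = w := fun h h' => tendsto_nhds_unique h h'
  -- The pointwise limits form a sesquilinear form bounded by `C`, which the Riesz representation
  -- turns into an operator.
  let S : H →ₗ⋆[ℂ] H →ₗ[ℂ] ℂ := LinearMap.mk₂'ₛₗ _ _ b
    (fun u u' v => huniq (hb _ _) (by
      simpa only [map_add, inner_add_left] using (hb u v).add (hb u' v)))
    (fun c u v => huniq (hb _ _) (by
      simpa only [map_smul, inner_smul_left, smul_eq_mul] using (hb u v).const_mul
        ((starRingEnd ℂ) c)))
    (fun u v v' => huniq (hb _ _) (by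
      simpa only [inner_add_right] using (hb u v).add (hb u v')))
    (fun c u v => huniq (hb _ _) (by
      simpa only [inner_smul_right, smul_eq_mul, RingHom.id_apply] using (hb u v).const_mul c))
  have hS : ∀ u v, ‖S u v‖ ≤ C * ‖u‖ * ‖v‖ := fun u v => le_of_tendsto (hb u v).norm (hbd u v)
  refine ⟨InnerProductSpace.continuousLinearMapOfBilin (S.mkContinuous₂ C hS), fun u v => ?_⟩
  have h1 : ⟪InnerProductSpace.continuousLinearMapOfBilin (S.mkContinuous₂ C hS) v, u⟫_ℂ = b v u :=
    InnerProductSpace.continuousLinearMapOfBilin_apply _ v u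
  rw [← inner_conj_symm, h1]
  have h2 := (Complex.continuous_conj.tendsto _).comp (hb v u)
  refine h2.congr fun i => ?_
  simp

/-- On norm bounded families weak convergence implies ultraweak convergence: the series for the
inner product is dominated by a multiple of `‖η n‖ ‖ξ n‖`. -/
theorem tendsto_inner_ampl {α ι : Type*} (F : Filter α) (T : α → H →L[ℂ] H) (C : ℝ)
    (hT : ∀ᶠ i in F, ‖T i‖ ≤ C) (T₀ : H →L[ℂ] H)
    (h : ∀ u v, Filter.Tendsto (fun i => ⟪u, T i v⟫_ℂ) F (nhds ⟪u, T₀ v⟫_ℂ))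
    (η ξ : lp (fun _ : ι => H) 2) :
    Filter.Tendsto (fun i => ⟪η, ampl ι (T i) ξ⟫_ℂ) F (nhds ⟪η, ampl ι T₀ ξ⟫_ℂ) := by
  simp only [lp.inner_eq_tsum, ampl_apply]
  refine tendsto_tsum_of_dominated_convergence (bound := fun n => ‖η n‖ * (C * ‖ξ n‖)) ?_
    (fun n => h _ _) ?_
  · have h1 := (lp.memℓp η).summable (by simp)
    have h2 := (lp.memℓp ξ).summable (by simp)
    simp only [ENNReal.toReal_ofNat, Real.rpow_ofNat] at h1 h2
    refine Summable.of_norm_bounded (g := fun n => |C| * (‖η n‖ ^ 2 + ‖ξ n‖ ^ 2))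
      ((h1.add h2).mul_left _) fun n => ?_
    rw [Real.norm_eq_abs, mul_left_comm, abs_mul, abs_of_nonneg (by positivity : 0 ≤ ‖η n‖ * ‖ξ n‖)]
    gcongr
    nlinarith [sq_nonneg (‖η n‖ - ‖ξ n‖), sq_nonneg ‖η n‖, sq_nonneg ‖ξ n‖]
  · filter_upwards [hT] with i hi n
    refine (norm_inner_le_norm _ _).trans ?_
    gcongr
    exact (T i).le_of_opNorm_le hi _

end Operators

/-! ### Bicommutants, normal traces and ultraweak limits. -/

section Tracial

variable {H : Type u} [NormedAddCommGroup H] [InnerProductSpace ℂ H] [CompleteSpace H]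
variable {M : VonNeumannAlgebra H}

theorem mem_wStar_iff (A : StarSubalgebra ℂ (Elt M)) (y : Elt M) :
    y ∈ wStar A ↔ ∀ s : H →L[ℂ] H, (∀ a ∈ A, (a : H →L[ℂ] H) * s = s * (a : H →L[ℂ] H)) →
      s * (y : H →L[ℂ] H) = (y : H →L[ℂ] H) * s := by
  have key : ∀ s : H →L[ℂ] H, s ∈ StarSubalgebra.centralizer ℂ
      (A.map M.toStarSubalgebra.subtype : Set (H →L[ℂ] H)) ↔
      ∀ a ∈ A, (a : H →L[ℂ] H) * s = s * (a : H →L[ℂ] H) := by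
    intro s
    rw [StarSubalgebra.mem_centralizer_iff]
    constructor
    · intro h a ha
      exact (h _ ⟨a, ha, rfl⟩).1
    · rintro h _ ⟨a, ha, rfl⟩
      exact ⟨h a ha, h (star a) (star_mem ha)⟩
  rw [wStar, StarSubalgebra.mem_comap, StarSubalgebra.mem_centralizer_iff]
  constructor
  · intro h s hs
    exact (h s ((key s).mpr hs)).1
  · intro h s hs
    exact ⟨h s ((key s).mp hs), h _ ((key _).mp (star_mem hs))⟩

theorem wStar_wStar_le (A : StarSubalgebra ℂ (Elt M)) : wStar (wStar A) ≤ wStar A := by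
  intro y hy
  rw [mem_wStar_iff] at hy ⊢
  exact fun s hs => hy s fun a ha => ((mem_wStar_iff A a).mp ha s hs).symm

theorem IsWStar.wStar_le {N : StarSubalgebra ℂ (Elt M)} (hN : IsWStar N) : wStar N ≤ N := by
  obtain ⟨N', hN'⟩ := hN
  intro y hy
  rw [mem_wStar_iff] at hy
  have hmem : ∀ x : H →L[ℂ] H, x ∈ N' ↔ ∃ a ∈ N, (a : H →L[ℂ] H) = x := by
    intro x
    change x ∈ N'.toStarSubalgebra ↔ _
    rw [hN']
    rfl
  have h : (y : H →L[ℂ] H) ∈ N' := by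
    rw [← N'.commutant_commutant, VonNeumannAlgebra.mem_commutant_iff]
    intro s hs
    rw [VonNeumannAlgebra.mem_commutant_iff] at hs
    exact hy s fun a ha => hs _ ((hmem _).mpr ⟨a, ha, rfl⟩)
  obtain ⟨a, ha, hay⟩ := (hmem _).mp h
  rwa [← Subtype.ext hay]

/-- Operators in the bicommutant of a bicommutant closed subalgebra belong to it. -/
theorem exists_mem_of_commute {N : StarSubalgebra ℂ (Elt M)} (hN : wStar N ≤ N) (T : H →L[ℂ] H)
    (hT : ∀ s : H →L[ℂ] H, (∀ a ∈ N, (a : H →L[ℂ] H) * s = s * (a : H →L[ℂ] H)) →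
      s * T = T * s) : ∃ h ∈ N, (h : H →L[ℂ] H) = T := by
  have hM : T ∈ M := by
    rw [← M.commutant_commutant, VonNeumannAlgebra.mem_commutant_iff]
    intro s hs
    rw [VonNeumannAlgebra.mem_commutant_iff] at hs
    exact hT s fun a _ => hs _ a.2
  exact ⟨⟨T, hM⟩, hN ((mem_wStar_iff _ _).mpr hT), rfl⟩

theorem exists_cfc_mem {N : StarSubalgebra ℂ (Elt M)} (hN : wStar N ≤ N) (a : Elt M) (ha : a ∈ N)
    (f : ℝ → ℝ) : ∃ h ∈ N, (h : H →L[ℂ] H) = cfc f (a : H →L[ℂ] H) :=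
  exists_mem_of_commute hN _ fun _ hs => (Commute.cfc_real (hs a ha) f).symm.eq

variable {τ : Elt M →ₗ[ℂ] ℂ}

/-- The series in the definition of normality is a single inner product in `ℓ²(ℕ, H)`. Limits of
vectors there are therefore enough to control `τ`. -/
theorem IsTraceState.exists_vectors (hτ : IsTraceState τ) :
    ∃ η ξ : lp (fun _ : ℕ => H) 2, ∀ x : Elt M, τ x = ⟪η, ampl ℕ (x : H →L[ℂ] H) ξ⟫_ℂ := by
  obtain ⟨ξ, η, hξ, hη, h⟩ := hτ.normal
  refine ⟨⟨η, memℓp_gen (by simpa using hη)⟩, ⟨ξ, memℓp_gen (by simpa using hξ)⟩, fun x => ?_⟩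
  rw [lp.inner_eq_tsum]
  exact (h x).tsum_eq.symm

/-- The condition is closed in the vector `a ξ`, and `ampl_mem_closure` places `y ξ` in the closure
of the vectors `a ξ`. -/
theorem IsTraceState.mul_eq_zero_of_mem_wStar (hτ : IsTraceState τ)
    {A : StarSubalgebra ℂ (Elt M)} {w : Elt M} (hw : ∀ a ∈ A, τ (w * a) = 0) {y : Elt M}
    (hy : y ∈ wStar A) : τ (w * y) = 0 := by
  obtain ⟨η, ξ, h⟩ := hτ.exists_vectors
  have hmul : ∀ a : Elt M, τ (w * a) =
      ⟪η, ampl ℕ (w : H →L[ℂ] H) (ampl ℕ (a : H →L[ℂ] H) ξ)⟫_ℂ := fun a => h _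
  rw [hmul]
  have hcl := ampl_mem_closure (A.map M.toStarSubalgebra.subtype) (y : H →L[ℂ] H)
    (fun s hs => (mem_wStar_iff A y).mp hy s fun a ha => hs _ ⟨a, ha, rfl⟩) ξ
  have hclosed : IsClosed {v : lp (fun _ : ℕ => H) 2 | ⟪η, ampl ℕ (w : H →L[ℂ] H) v⟫_ℂ = 0} :=
    isClosed_eq (by fun_prop) continuous_const
  refine hclosed.closure_subset_iff.mpr ?_ hcl
  rintro _ ⟨_, ⟨a, ha, rfl⟩, rfl⟩
  exact (hmul a).symm.trans (hw a ha)

theorem wStar_top_le : wStar (⊤ : StarSubalgebra ℂ (Elt M)) ≤ ⊤ := le_top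

theorem exists_star_mul_self (p : Elt M) (hp : 0 ≤ (p : H →L[ℂ] H)) :
    ∃ r : Elt M, p = star r * r := by
  obtain ⟨r, -, hr⟩ := exists_cfc_mem wStar_top_le p trivial Real.sqrt
  refine ⟨r, Subtype.ext ?_⟩
  have hp' : IsSelfAdjoint (p : H →L[ℂ] H) := IsSelfAdjoint.of_nonneg hp
  have hsa : star (r : H →L[ℂ] H) = r := by
    rw [hr]
    exact (cfc_predicate Real.sqrt (p : H →L[ℂ] H) : IsSelfAdjoint _)
  change (p : H →L[ℂ] H) = star (r : H →L[ℂ] H) * r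
  rw [hsa, hr, ← cfc_mul Real.sqrt Real.sqrt _ (by fun_prop) (by fun_prop)]
  conv_lhs => rw [← cfc_id' ℝ (p : H →L[ℂ] H)]
  exact cfc_congr fun x hx => (Real.mul_self_sqrt (spectrum_nonneg_of_nonneg hp hx)).symm

/-- With `p = r* r` and `q = s* s`, the trace property turns `τ(p q)` into `τ((r s*)* (r s*))`. -/
theorem IsTraceState.mul_nonneg (hτ : IsTraceState τ) (p q : Elt M) (hp : 0 ≤ (p : H →L[ℂ] H))
    (hq : 0 ≤ (q : H →L[ℂ] H)) : 0 ≤ τ (p * q) := by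
  obtain ⟨r, rfl⟩ := exists_star_mul_self p hp
  obtain ⟨s, rfl⟩ := exists_star_mul_self q hq
  have h := hτ.nonneg (r * star s)
  rw [star_mul, star_star] at h
  have : τ (star r * r * (star s * s)) = τ (s * star r * (r * star s)) := by
    rw [← mul_assoc, hτ.trace]
    simp only [mul_assoc]
  rwa [this]

/-- Positivity makes `τ(y* y)` real. Taking `y = 1 + x` compares the imaginary parts of `τ(x)` and
`τ(x*)`, and `y = 1 + i x` their real parts. -/
theorem IsTraceState.map_star (hτ : IsTraceState τ) (x : Elt M) : τ (star x) = star (τ x) := by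
  have h1 := hτ.nonneg (1 + x)
  have h2 := hτ.nonneg (1 + Complex.I • x)
  have h3 := hτ.nonneg x
  have e1 : τ (star (1 + x) * (1 + x)) = 1 + τ x + τ (star x) + τ (star x * x) := by
    simp only [star_add, star_one, add_mul, mul_add, one_mul, mul_one, map_add, hτ.map_one]
    ring
  have e2 : τ (star (1 + Complex.I • x) * (1 + Complex.I • x)) =
      1 + Complex.I * τ x - Complex.I * τ (star x) + τ (star x * x) := by
    have : star (1 + Complex.I • x) * (1 + Complex.I • x) =
        1 + Complex.I • x - Complex.I • star x + star x * x := by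
      have hI : star (Complex.I • x) = -(Complex.I • star x) := by
        rw [star_smul]; simp
      have hII : Complex.I • star x * Complex.I • x = -(star x * x) := by
        rw [smul_mul_smul_comm]; simp
      rw [star_add, star_one, hI, add_mul, mul_add, mul_add, neg_mul, neg_mul, hII]
      simp [sub_eq_add_neg, add_assoc]
    rw [this]
    simp [hτ.map_one]
  rw [e1] at h1
  rw [e2] at h2
  have i1 := (Complex.nonneg_iff.mp h1).2
  have i2 := (Complex.nonneg_iff.mp h2).2
  have i3 := (Complex.nonneg_iff.mp h3).2
  simp at i1 i2
  rw [← i3] at i1 i2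
  refine Complex.ext ?_ ?_
  · simp; linarith
  · simp; linarith

/-- The positive contractions in `N`. -/
def posUnit (N : StarSubalgebra ℂ (Elt M)) : Set (Elt M) :=
  {h | h ∈ N ∧ 0 ≤ (h : H →L[ℂ] H) ∧ (h : H →L[ℂ] H) ≤ 1}

/-- Commuting with the commutant of `N` and lying between `0` and `1` both pass to weak limits, and
on bounded sets `τ(· a)` is weakly continuous. -/
theorem IsTraceState.exists_limit_mem_posUnit (hτ : IsTraceState τ) {N : StarSubalgebra ℂ (Elt M)}
    (hN : wStar N ≤ N) (F : Ultrafilter (Elt M))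
    (hF : ∀ᶠ h in (F : Filter (Elt M)), h ∈ posUnit N) :
    ∃ h₀ ∈ posUnit N, ∀ a : Elt M, Filter.Tendsto (fun h => τ (h * a)) F (nhds (τ (h₀ * a))) := by
  have hbd : ∀ᶠ h : Elt M in (F : Filter (Elt M)), ‖(h : H →L[ℂ] H)‖ ≤ 1 :=
    hF.mono fun h hh => (CStarAlgebra.norm_le_one_iff_of_nonneg _ hh.2.1).mpr hh.2.2
  obtain ⟨T₀, hT₀⟩ := exists_weak_limit F (fun h : Elt M => (h : H →L[ℂ] H)) 1 hbd
  have huniq : ∀ {f : Elt M → ℂ} {z w : ℂ}, Filter.Tendsto f F (nhds z) →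
      Filter.Tendsto f F (nhds w) → z = w := fun h h' => tendsto_nhds_unique h h'
  obtain ⟨h₀, hh₀, rfl⟩ := exists_mem_of_commute hN T₀ (by
    intro s hs
    ext v
    refine ext_inner_left ℂ fun u => ?_
    have l1 := hT₀ (star s u) v
    have l2 := hT₀ u (s v)
    simp only [ContinuousLinearMap.star_eq_adjoint, ContinuousLinearMap.adjoint_inner_left] at l1
    refine huniq l1 (l2.congr' ?_)
    filter_upwards [hF] with h hh
    exact congrArg (fun S => ⟪u, S v⟫_ℂ) (hs h hh.1))
  refine ⟨h₀, ⟨hh₀, ?_, ?_⟩, fun a => ?_⟩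
  · rw [operator_nonneg_iff]
    intro v
    refine ge_of_tendsto (hT₀ v v) ?_
    filter_upwards [hF] with h hh
    exact (operator_nonneg_iff _).mp hh.2.1 v
  · rw [← sub_nonneg, operator_nonneg_iff]
    intro v
    have l := (hT₀ v v).const_sub ⟪v, v⟫_ℂ
    rw [sub_apply, inner_sub_right]
    refine ge_of_tendsto l ?_
    filter_upwards [hF] with h hh
    have := (operator_nonneg_iff _).mp (sub_nonneg.mpr hh.2.2) v
    rwa [sub_apply, inner_sub_right] at this
  · obtain ⟨η, ξ, h⟩ := hτ.exists_vectors
    have hmul : ∀ h : Elt M, τ (h * a) =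
        ⟪η, ampl ℕ (h : H →L[ℂ] H) (ampl ℕ (a : H →L[ℂ] H) ξ)⟫_ℂ := fun b => h _
    simp only [hmul]
    exact tendsto_inner_ampl _ _ 1 hbd _ hT₀ _ _

end Tracial

/-! ### Hahn-Banach separation in the weak topology of a pairing. -/

section WeakTopology

variable {E F : Type*} [AddCommGroup E] [Module ℂ E] [AddCommGroup F] [Module ℂ F]

theorem tendsto_weakBilin {α : Type*} (b : E →ₗ[ℂ] F →ₗ[ℂ] ℂ) (l : Filter α)
    (f : α → WeakBilin b) (x : WeakBilin b)
    (h : ∀ y, Filter.Tendsto (fun i => b (f i) y) l (nhds (b x y))) :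
    Filter.Tendsto f l (nhds x) := by
  rw [nhds_induced, Filter.tendsto_comap_iff, tendsto_pi_nhds]
  exact h

/-- The pairing may be degenerate in `E`, so `K` is separated from the closed affine set `t` of all
elements indistinguishable from `x`, instead of from the point `x`. Weakly continuous functionals
are pairings with elements of `F`. -/
theorem exists_separating (b : E →ₗ[ℂ] F →ₗ[ℂ] ℂ) (K : Set (WeakBilin b)) (hK : IsCompact K)
    (hconv : ∀ y ∈ K, ∀ z ∈ K, ∀ r s : ℝ, 0 ≤ r → 0 ≤ s → r + s = 1 →
      (r : ℂ) • y + (s : ℂ) • z ∈ K)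
    (x : E) (h : ∀ y ∈ K, ∃ a, b y a ≠ b x a) :
    ∃ a : F, ∃ u v : ℝ, (∀ y ∈ K, (b y a).re < u) ∧ u < v ∧ v < (b x a).re := by
  let : Module ℝ E := Module.complexToReal E
  let t : Set (WeakBilin b) := {y | ∀ a : F, b y a = b x a}
  have htconv : Convex ℝ t := by
    intro y hy z hz r s _ _ hrs a
    have key : ∀ y z : E, b y a = b x a → b z a = b x a →
        b ((r : ℂ) • y + (s : ℂ) • z) a = b x a := by
      intro y z hy hz
      rw [map_add, map_smul, map_smul, LinearMap.add_apply, LinearMap.smul_apply,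
        LinearMap.smul_apply, hy, hz, ← add_smul, ← Complex.ofReal_add, hrs]
      simp
    exact key y z (hy a) (hz a)
  have htcl : IsClosed t := by
    have : t = ⋂ a : F, {y : WeakBilin b | b y a = b x a} := by
      ext y; simp [t]
    rw [this]
    exact isClosed_iInter fun a => isClosed_eq (WeakBilin.eval_continuous b a) continuous_const
  have hdisj : Disjoint K t := Set.disjoint_left.mpr fun y hy hyt => by
    obtain ⟨a, ha⟩ := h y hy
    exact ha (hyt a)
  obtain ⟨f, u, v, hu, huv, hv⟩ := RCLike.geometric_hahn_banach_compact_closed (𝕜 := ℂ)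
    (fun y hy z hz r s hr hs hrs => hconv y hy z hz r s hr hs hrs) hK htconv htcl hdisj
  obtain ⟨a, rfl⟩ := LinearMap.dualEmbedding_surjective b f
  exact ⟨a, u, v, hu, huv, hv x fun _ => rfl⟩

end WeakTopology

/-! ### Construction of the conditional expectation by trace duality. -/

section Tracial

variable {H : Type u} [NormedAddCommGroup H] [InnerProductSpace ℂ H] [CompleteSpace H]
variable {M : VonNeumannAlgebra H} {τ : Elt M →ₗ[ℂ] ℂ}

/-- The pairing `(x, a) ↦ τ (x a)` of `M` with a subalgebra `N`. -/
def tracePairing (τ : Elt M →ₗ[ℂ] ℂ) (N : StarSubalgebra ℂ (Elt M)) : Elt M →ₗ[ℂ] N →ₗ[ℂ] ℂ :=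
  LinearMap.mk₂ ℂ (fun x a => τ (x * a))
    (fun x y a => by rw [add_mul, map_add]) (fun c x a => by rw [smul_mul_assoc, map_smul])
    (fun x a b => by rw [← map_add, ← mul_add]; rfl)
    (fun c x a => by rw [← map_smul, ← mul_smul_comm]; rfl)

theorem IsTraceState.isCompact_posUnit (hτ : IsTraceState τ) {N : StarSubalgebra ℂ (Elt M)}
    (hN : wStar N ≤ N) : IsCompact (X := WeakBilin (tracePairing τ N)) (posUnit N) := by
  refine isCompact_iff_ultrafilter_le_nhds.mpr fun F hF => ?_
  obtain ⟨h₀, hh₀, hlim⟩ := hτ.exists_limit_mem_posUnit hN F (Filter.le_principal_iff.mp hF)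
  refine ⟨h₀, hh₀, ?_⟩
  exact tendsto_weakBilin (α := WeakBilin (tracePairing τ N)) (tracePairing τ N)
    (F : Filter (WeakBilin (tracePairing τ N))) (fun h => h) h₀ fun a => hlim a

/-- For self-adjoint `b ∈ N`, the functional `τ (· b)` on positive contractions is maximised,
up to `ε`, on the positive contractions of `N`. -/
theorem IsTraceState.exists_posUnit_ge (hτ : IsTraceState τ) {N : StarSubalgebra ℂ (Elt M)}
    (hN : wStar N ≤ N) {x b : Elt M} (hx₀ : 0 ≤ (x : H →L[ℂ] H)) (hx₁ : (x : H →L[ℂ] H) ≤ 1)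
    (hb : b ∈ N) (hsa : star b = b) {ε : ℝ} (hε : 0 < ε) :
    ∃ h ∈ posUnit N, τ (x * b) ≤ τ (h * b) + ε := by
  have hsa' : IsSelfAdjoint (b : H →L[ℂ] H) := congrArg Subtype.val hsa
  -- The natural maximiser is the spectral projection of `b` for `(0, ∞)`. This `f` is a continuous
  -- substitute, available to the continuous functional calculus at the cost of `ε`.
  let f : ℝ → ℝ := fun t => max 0 (min 1 (t / ε))
  have hf : Continuous f := by fun_prop
  have hf0 : ∀ t, 0 ≤ f t := fun t => le_max_left _ _
  have hf1 : ∀ t, f t ≤ 1 := fun t => max_le zero_le_one (min_le_left _ _)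
  have hft : ∀ t, 0 ≤ f t * t := by
    intro t
    rcases le_total 0 t with ht | ht
    · exact _root_.mul_nonneg (hf0 t) ht
    · have : f t = 0 := max_eq_left
        ((min_le_right _ _).trans (div_nonpos_of_nonpos_of_nonneg ht hε.le))
      rw [this, zero_mul]
  have hft' : ∀ t, t ≤ f t * t + ε := by
    intro t
    rcases le_total t ε with ht | ht
    · linarith [hft t]
    · have : f t = 1 := by
        have : 1 ≤ t / ε := (one_le_div hε).mpr ht
        simp [f, this]
      rw [this]; linarith
  obtain ⟨h, hhN, hh⟩ := exists_cfc_mem hN b hb f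
  have hmul : ((h * b : Elt M) : H →L[ℂ] H) = cfc (fun t => f t * t) (b : H →L[ℂ] H) := by
    change (h : H →L[ℂ] H) * b = _
    rw [cfc_mul f (fun t => t) _ (by fun_prop) (by fun_prop), cfc_id' ℝ (b : H →L[ℂ] H), hh]
  have hadd : ((h * b + (ε : ℂ) • (1 : Elt M) : Elt M) : H →L[ℂ] H) =
      cfc (fun t => f t * t + ε) (b : H →L[ℂ] H) := by
    rw [cfc_add (b : H →L[ℂ] H) (fun t => f t * t) (fun _ => ε) (by fun_prop) (by fun_prop), ← hmul,
      cfc_const ε (b : H →L[ℂ] H)]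
    congr 1
  refine ⟨h, ⟨hhN, ?_, ?_⟩, ?_⟩
  · rw [hh]; exact cfc_nonneg fun t _ => hf0 t
  · rw [hh]; exact cfc_le_one _ _ fun t _ => hf1 t
  -- Since `p ≥ b` and `p ≥ 0`, one gets `τ(x b) ≤ τ(x p) ≤ τ(p) = τ(h b) + ε`.
  · set p : Elt M := h * b + (ε : ℂ) • (1 : Elt M) with hp
    have h1 : 0 ≤ τ (x * (p - b)) := by
      refine hτ.mul_nonneg _ _ hx₀ ?_
      change 0 ≤ (p : H →L[ℂ] H) - b
      rw [sub_nonneg, hadd]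
      conv_lhs => rw [← cfc_id' ℝ (b : H →L[ℂ] H)]
      exact cfc_mono (fun t _ => hft' t) (by fun_prop) (by fun_prop)
    have h2 : 0 ≤ τ ((1 - x) * p) := by
      refine hτ.mul_nonneg _ _ (sub_nonneg.mpr hx₁) ?_
      rw [hadd]
      exact cfc_nonneg fun t _ => add_nonneg (hft t) hε.le
    have h3 : τ p = τ (h * b) + ε := by simp [hp, hτ.map_one]
    rw [← h3]
    rw [mul_sub, map_sub, sub_nonneg] at h1
    rw [sub_mul, one_mul, map_sub, sub_nonneg] at h2
    exact h1.trans h2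

/-- Otherwise some `a ∈ N` strictly separates `x` from the compact convex set `posUnit N`. This
contradicts `exists_posUnit_ge`, applied to the real part of `a` with `ε` the width of the gap. -/
theorem IsTraceState.exists_representative (hτ : IsTraceState τ) {N : StarSubalgebra ℂ (Elt M)}
    (hN : wStar N ≤ N) {x : Elt M} (hx₀ : 0 ≤ (x : H →L[ℂ] H)) (hx₁ : (x : H →L[ℂ] H) ≤ 1) :
    ∃ h ∈ N, ∀ a ∈ N, τ (h * a) = τ (x * a) := by
  by_contra! hcon
  have hconv : ∀ y ∈ posUnit N, ∀ z ∈ posUnit N, ∀ r s : ℝ, 0 ≤ r → 0 ≤ s →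
      r + s = 1 → (r : ℂ) • y + (s : ℂ) • z ∈ posUnit N := by
    rintro y ⟨hy, hy0, hy1⟩ z ⟨hz, hz0, hz1⟩ r s hr hs hrs
    have hco : (((r : ℂ) • y + (s : ℂ) • z : Elt M) : H →L[ℂ] H) =
      r • (y : H →L[ℂ] H) + s • (z : H →L[ℂ] H) := rfl
    refine ⟨add_mem (N.smul_mem hy (r : ℂ)) (N.smul_mem hz (s : ℂ)), ?_, ?_⟩
    · exact hco ▸ add_nonneg (smul_nonneg hr hy0) (smul_nonneg hs hz0)
    · refine hco ▸ ?_
      calc r • (y : H →L[ℂ] H) + s • (z : H →L[ℂ] H) ≤ r • 1 + s • 1 :=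
            add_le_add (smul_le_smul_of_nonneg_left hy1 hr)
              (smul_le_smul_of_nonneg_left hz1 hs)
        _ = 1 := by rw [← add_smul, hrs, one_smul]
  obtain ⟨a, u, v, hu, huv, hv⟩ := exists_separating (tracePairing τ N) (posUnit N)
    (hτ.isCompact_posUnit hN) hconv x (fun y hy => by
      obtain ⟨a, ha, hne⟩ := hcon y hy.1
      exact ⟨⟨a, ha⟩, hne⟩)
  -- For self-adjoint `h` only the self-adjoint part of `a` contributes to the real part of `τ(h
  -- a)`.
  have hre : ∀ h : Elt M, star h = h →
      (τ (h * ((1 / 2 : ℂ) • ((a : Elt M) + star (a : Elt M))))).re = (τ (h * a)).re := by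
    intro h hh
    have : τ (h * star (a : Elt M)) = star (τ (h * a)) := by
      rw [← hτ.map_star, star_mul, hh, hτ.trace]
    rw [mul_smul_comm, map_smul, mul_add, map_add, this]
    simp
    ring
  have hsa : ∀ h : Elt M, 0 ≤ (h : H →L[ℂ] H) → star h = h := fun h hh =>
    Subtype.ext (IsSelfAdjoint.of_nonneg hh)
  obtain ⟨h, hh, hle⟩ := hτ.exists_posUnit_ge hN hx₀ hx₁
    (b := (1 / 2 : ℂ) • ((a : Elt M) + star (a : Elt M)))
    (N.smul_mem (add_mem a.2 (star_mem a.2)) _)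
    (by rw [star_smul, star_add, star_star, add_comm]; simp) (sub_pos.mpr huv)
  have h1 := hu h hh
  have h3 := (Complex.le_def.mp hle).1
  rw [Complex.add_re, hre x (hsa x hx₀), hre h (hsa h hh.2.1)] at h3
  change (τ (h * a)).re < u at h1
  change v < (τ (x * a)).re at hv
  simp at h3
  linarith

theorem IsTraceState.exists_representative' (hτ : IsTraceState τ) {N : StarSubalgebra ℂ (Elt M)}
    (hN : wStar N ≤ N) (x : Elt M) : ∃ h ∈ N, ∀ a ∈ N, τ (h * a) = τ (x * a) := by
  let R : Submodule ℂ (Elt M) :=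
    { carrier := {x | ∃ h ∈ N, ∀ a ∈ N, τ (h * a) = τ (x * a)}
      add_mem' := by
        rintro x y ⟨h, hh, hx⟩ ⟨k, hk, hy⟩
        exact ⟨h + k, add_mem hh hk, fun a ha => by
          rw [add_mul, add_mul, map_add, map_add, hx a ha, hy a ha]⟩
      zero_mem' := ⟨0, zero_mem N, fun _ _ => rfl⟩
      smul_mem' := by
        rintro c x ⟨h, hh, hx⟩
        exact ⟨c • h, N.smul_mem hh c, fun a ha => by
          rw [smul_mul_assoc, smul_mul_assoc, map_smul, map_smul, hx a ha]⟩ }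
  have hone : (1 : Elt M) ∈ R := ⟨1, one_mem N, fun _ _ => rfl⟩
  have hsa : ∀ y : Elt M, star y = y → y ∈ R := by
    intro y hy
    have hy' : IsSelfAdjoint (y : H →L[ℂ] H) := congrArg Subtype.val hy
    set c : ℝ := ‖(y : H →L[ℂ] H)‖ + 1 with hc
    have hcpos : 0 < c := by positivity
    have hle : ∀ z : H →L[ℂ] H, IsSelfAdjoint z → ‖z‖ = ‖(y : H →L[ℂ] H)‖ →
        z ≤ c • (1 : H →L[ℂ] H) := by
      intro z hz hzy
      refine (IsSelfAdjoint.le_algebraMap_norm_self hz).trans ?_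
      rw [Algebra.algebraMap_eq_smul_one, hzy]
      exact smul_le_smul_of_nonneg_right (by linarith) zero_le_one
    -- The affine map `t ↦ (t + c) / 2c` sends `[-c, c]` onto `[0, 1]`, so `z` is a positive
    -- contraction. The summand `1` in `c` keeps `c` positive when `y = 0`.
    let z : Elt M := ((1 / (2 * c) : ℝ) : ℂ) • (y + (c : ℂ) • (1 : Elt M))
    have hz : (z : H →L[ℂ] H) = (1 / (2 * c)) • ((y : H →L[ℂ] H) + c • 1) := rfl
    have h1 := hle _ hy' rfl
    have h2 := hle _ hy'.neg (norm_neg _)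
    have hzR : z ∈ R := by
      refine hτ.exists_representative hN ?_ ?_
      · rw [hz]
        refine smul_nonneg (by positivity) ?_
        rw [add_comm]
        exact neg_le_iff_add_nonneg.mp h2
      · rw [hz]
        calc (1 / (2 * c)) • ((y : H →L[ℂ] H) + c • 1)
            ≤ (1 / (2 * c)) • (c • (1 : H →L[ℂ] H) + c • 1) :=
              smul_le_smul_of_nonneg_left (add_le_add_left h1 _) (by positivity)
          _ = 1 := by
            rw [← add_smul, smul_smul]
            have : 1 / (2 * c) * (c + c) = 1 := by field_simp; ring
            rw [this, one_smul]
    have hyz : y = ((2 * c : ℝ) : ℂ) • z - (c : ℂ) • (1 : Elt M) := by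
      simp only [z]
      rw [smul_smul, ← Complex.ofReal_mul]
      have : 2 * c * (1 / (2 * c)) = 1 := by field_simp
      rw [this]
      simp
    rw [hyz]
    exact sub_mem (R.smul_mem _ hzR) (R.smul_mem _ hone)
  have hx : x = (1 / 2 : ℂ) • (x + star x) +
      (-Complex.I / 2) • (Complex.I • (x - star x)) := by
    rw [smul_smul]
    have : -Complex.I / 2 * Complex.I = 1 / 2 := by
      rw [neg_div, neg_mul, div_mul_eq_mul_div, Complex.I_mul_I]; norm_num
    rw [this, ← smul_add, add_add_sub_cancel, ← two_smul ℂ x, smul_smul]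
    norm_num
  change x ∈ R
  rw [hx]
  refine add_mem (R.smul_mem _ (hsa _ ?_)) (R.smul_mem _ (hsa _ ?_))
  · rw [star_add, star_star, add_comm]
  · rw [star_smul, star_sub, star_star]
    simp [← smul_neg]

theorem IsTraceState.eq_of_forall_mul (hτ : IsTraceState τ) {N : StarSubalgebra ℂ (Elt M)}
    {h k : Elt M} (hh : h ∈ N) (hk : k ∈ N) (H : ∀ a ∈ N, τ (h * a) = τ (k * a)) : h = k := by
  refine sub_eq_zero.mp (hτ.faithful _ ?_)
  rw [hτ.trace, sub_mul, map_sub, H _ (star_mem (sub_mem hh hk)), sub_self]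

/-- By faithfulness an element of `N` is determined by its trace pairing with `N`. Linearity and
bimodularity of the chosen representatives follow. -/
theorem IsTraceState.exists_isCondExp (hτ : IsTraceState τ) {N : StarSubalgebra ℂ (Elt M)}
    (hN : wStar N ≤ N) : ∃ E, IsCondExp τ N E := by
  choose E hE hτE using hτ.exists_representative' hN
  refine ⟨⟨⟨E, fun x y => ?_⟩, fun c x => ?_⟩, hE, fun n hn => ?_, fun n hn x => ?_,
    fun n hn x => ?_, fun x => ?_⟩
  · refine hτ.eq_of_forall_mul (hE _) (add_mem (hE x) (hE y)) fun a ha => ?_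
    rw [hτE _ a ha, add_mul, add_mul, map_add, map_add, hτE x a ha, hτE y a ha]
  · refine hτ.eq_of_forall_mul (hE _) (N.smul_mem (hE x) c) fun a ha => ?_
    rw [hτE _ a ha]
    simp only [RingHom.id_apply]
    rw [smul_mul_assoc, smul_mul_assoc, map_smul, map_smul, hτE x a ha]
  · exact hτ.eq_of_forall_mul (hE _) hn fun a ha => hτE n a ha
  · refine hτ.eq_of_forall_mul (hE _) (mul_mem hn (hE x)) fun a ha => ?_
    change τ (E (n * x) * a) = τ (n * E x * a)
    rw [hτE _ a ha, mul_assoc, mul_assoc, hτ.trace, hτ.trace n, mul_assoc, mul_assoc,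
      hτE x _ (mul_mem ha hn)]
  · refine hτ.eq_of_forall_mul (hE _) (mul_mem (hE x) hn) fun a ha => ?_
    change τ (E (x * n) * a) = τ (E x * n * a)
    rw [hτE _ a ha, mul_assoc, mul_assoc, hτE x _ (mul_mem hn ha)]
  · have := hτE x 1 (one_mem N)
    simpa using this

theorem IsTraceState.isCondExp_condExp (hτ : IsTraceState τ) {N : StarSubalgebra ℂ (Elt M)}
    (hN : wStar N ≤ N) : IsCondExp τ N (condExp τ N) := by
  have h := hτ.exists_isCondExp hN
  rw [condExp, dif_pos h]
  exact h.choose_spec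

theorem IsTraceState.isCondExp_canonExp (hτ : IsTraceState τ) (A : StarSubalgebra ℂ (Elt M)) :
    IsCondExp τ (wStar A) (canonExp τ A) :=
  hτ.isCondExp_condExp (wStar_wStar_le A)

end Tracial

/-! ### Calculus in `N ⊗_S N` -/

section Algebraic

variable {R : Type u} [Ring R] [StarRing R] [Algebra ℂ R] [StarModule ℂ R]
variable {S N P : StarSubalgebra ℂ R}

/-- The bilinear map `(x, y) ↦ x ⊗ y` from `N × N` to `N ⊗_S N`. -/
def tmkHom (S N : StarSubalgebra ℂ R) : N →ₗ[ℂ] N →ₗ[ℂ] AmalgTensor S N :=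
  (TensorProduct.mk ℂ N N).compr₂ (balancedRel S N).mkQ

theorem tmk_eq (x y : N) : tmk S x y = tmkHom S N x y := rfl

theorem tmk_add_left (x x' y : N) : tmk S (x + x') y = tmk S x y + tmk S x' y := by
  simp [tmk_eq]

theorem tmk_add_right (x y y' : N) : tmk S x (y + y') = tmk S x y + tmk S x y' := by
  simp [tmk_eq]

theorem tmk_smul_left (c : ℂ) (x y : N) : tmk S (c • x) y = c • tmk S x y := by simp [tmk_eq]

theorem tmk_smul_right (c : ℂ) (x y : N) : tmk S x (c • y) = c • tmk S x y := by simp [tmk_eq]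

theorem tmk_zero_left (y : N) : tmk S 0 y = 0 := by simp [tmk_eq]

theorem tmk_zero_right (x : N) : tmk S x 0 = 0 := by simp [tmk_eq]

theorem tmk_balanced (x y b : N) (hb : (b : R) ∈ S) : tmk S (x * b) y = tmk S x (b * y) := by
  rw [tmk, tmk, ← sub_eq_zero, ← map_sub]
  exact (Submodule.Quotient.mk_eq_zero _).mpr (Submodule.subset_span ⟨x, y, b, hb, rfl⟩)

theorem amalgTensor_hom_ext {V : Type*} [AddCommGroup V] [Module ℂ V]
    {f g : AmalgTensor S N →ₗ[ℂ] V} (h : ∀ x y, f (tmk S x y) = g (tmk S x y)) : f = g := by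
  refine Submodule.linearMap_qext _ (TensorProduct.ext' fun x y => h x y)

theorem lact_tmk (a x y : N) : lact S a (tmk S x y) = tmk S (a * x) y := rfl

theorem ract_tmk (a x y : N) : ract S a (tmk S x y) = tmk S x (y * a) := rfl

theorem tensorIncl_tmk (hSP : S ≤ P) (hPN : P ≤ N) (x y : P) :
    tensorIncl hSP hPN (tmk S x y) =
      tmk S (StarSubalgebra.inclusion hPN x) (StarSubalgebra.inclusion hPN y) := rfl

theorem lact_add (a b : N) : lact S (a + b) = lact S a + lact S b :=
  amalgTensor_hom_ext fun x y => by
    rw [LinearMap.add_apply, lact_tmk, lact_tmk, lact_tmk, add_mul, tmk_add_left]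

theorem ract_add (a b : N) : ract S (a + b) = ract S a + ract S b :=
  amalgTensor_hom_ext fun x y => by
    rw [LinearMap.add_apply, ract_tmk, ract_tmk, ract_tmk, mul_add, tmk_add_right]

theorem lact_smul (c : ℂ) (a : N) : lact S (c • a) = c • lact S a :=
  amalgTensor_hom_ext fun x y => by
    rw [LinearMap.smul_apply, lact_tmk, lact_tmk, smul_mul_assoc, tmk_smul_left]

theorem ract_smul (c : ℂ) (a : N) : ract S (c • a) = c • ract S a :=
  amalgTensor_hom_ext fun x y => by
    rw [LinearMap.smul_apply, ract_tmk, ract_tmk, mul_smul_comm, tmk_smul_right]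

theorem lact_mul (a b : N) (t : AmalgTensor S N) : lact S (a * b) t = lact S a (lact S b t) :=
  LinearMap.congr_fun (f := lact S (a * b)) (g := lact S a ∘ₗ lact S b)
    (amalgTensor_hom_ext fun x y => by simp [lact_tmk, mul_assoc]) t

theorem ract_mul (a b : N) (t : AmalgTensor S N) : ract S (a * b) t = ract S b (ract S a t) :=
  LinearMap.congr_fun (f := ract S (a * b)) (g := ract S b ∘ₗ ract S a)
    (amalgTensor_hom_ext fun x y => by simp [ract_tmk, mul_assoc]) t

theorem lact_ract (a b : N) (t : AmalgTensor S N) :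
    lact S a (ract S b t) = ract S b (lact S a t) :=
  LinearMap.congr_fun (f := lact S a ∘ₗ ract S b) (g := ract S b ∘ₗ lact S a)
    (amalgTensor_hom_ext fun _ _ => rfl) t

theorem lact_one (t : AmalgTensor S N) : lact S 1 t = t :=
  LinearMap.congr_fun (f := lact S (1 : N)) (g := LinearMap.id)
    (amalgTensor_hom_ext fun x y => by simp [lact_tmk]) t

theorem ract_one (t : AmalgTensor S N) : ract S 1 t = t :=
  LinearMap.congr_fun (f := ract S (1 : N)) (g := LinearMap.id)
    (amalgTensor_hom_ext fun x y => by simp [ract_tmk]) t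

theorem tensorIncl_lact (hSP : S ≤ P) (hPN : P ≤ N) (a : P) (t : AmalgTensor S P) :
    tensorIncl hSP hPN (lact S a t) =
      lact S (StarSubalgebra.inclusion hPN a) (tensorIncl hSP hPN t) :=
  LinearMap.congr_fun (f := tensorIncl hSP hPN ∘ₗ lact S a)
    (g := lact S (StarSubalgebra.inclusion hPN a) ∘ₗ tensorIncl hSP hPN)
    (amalgTensor_hom_ext fun _ _ => rfl) t

theorem tensorIncl_ract (hSP : S ≤ P) (hPN : P ≤ N) (a : P) (t : AmalgTensor S P) :
    tensorIncl hSP hPN (ract S a t) =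
      ract S (StarSubalgebra.inclusion hPN a) (tensorIncl hSP hPN t) :=
  LinearMap.congr_fun (f := tensorIncl hSP hPN ∘ₗ ract S a)
    (g := ract S (StarSubalgebra.inclusion hPN a) ∘ₗ tensorIncl hSP hPN)
    (amalgTensor_hom_ext fun _ _ => rfl) t

theorem IsDerivation.map_one {D : N →ₗ[ℂ] AmalgTensor S N} (hD : IsDerivation D) : D 1 = 0 := by
  have h := hD 1 1
  rw [lact_one, ract_one, mul_one] at h
  exact left_eq_add.mp h

/-- The `*`-algebra generated by `s` is generated by `s ∪ s*` as an algebra. -/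
theorem star_adjoin_induction {s : Set R} (hN : N ≤ StarAlgebra.adjoin ℂ s) (hs : s ⊆ N)
    {p : N → Prop} (mem : ∀ x : N, (x : R) ∈ s → p x) (smem : ∀ x : N, (x : R) ∈ s → p (star x))
    (one : p 1) (smul : ∀ (c : ℂ) x, p x → p (c • x)) (add : ∀ x y, p x → p y → p (x + y))
    (mul : ∀ x y, p x → p y → p (x * y)) (x : N) : p x := by
  let K : Subalgebra ℂ R :=
    { carrier := {x | ∃ hx : x ∈ N, p ⟨x, hx⟩}
      mul_mem' := by
        rintro x y ⟨hx, hpx⟩ ⟨hy, hpy⟩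
        exact ⟨mul_mem hx hy, mul _ _ hpx hpy⟩
      add_mem' := by
        rintro x y ⟨hx, hpx⟩ ⟨hy, hpy⟩
        exact ⟨add_mem hx hy, add _ _ hpx hpy⟩
      algebraMap_mem' := by
        intro c
        refine ⟨algebraMap_mem N c, ?_⟩
        have := smul c 1 one
        have e : (⟨algebraMap ℂ R c, algebraMap_mem N c⟩ : N) = c • 1 :=
          Subtype.ext (by simp [Algebra.algebraMap_eq_smul_one])
        rwa [e] }
  have h : (StarAlgebra.adjoin ℂ s).toSubalgebra ≤ K := by
    rw [StarAlgebra.adjoin_toSubalgebra, Algebra.adjoin_le_iff]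
    rintro y (hy | hy)
    · exact ⟨hs hy, mem ⟨y, hs hy⟩ hy⟩
    · have hy' : star y ∈ N := hs hy
      refine ⟨by simpa using star_mem hy', ?_⟩
      have := smem ⟨star y, hy'⟩ hy
      have e : star (⟨star y, hy'⟩ : N) = ⟨y, by simpa using star_mem hy'⟩ :=
        Subtype.ext (star_star y)
      rwa [e] at this
  obtain ⟨_, hx⟩ := h (hN x.2)
  exact hx

theorem sup_induction {A₁ A₂ : StarSubalgebra ℂ R} {p : ↥(A₁ ⊔ A₂) → Prop}
    (left : ∀ x : ↥(A₁ ⊔ A₂), (x : R) ∈ A₁ → p x) (right : ∀ x : ↥(A₁ ⊔ A₂), (x : R) ∈ A₂ → p x)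
    (add : ∀ x y, p x → p y → p (x + y)) (mul : ∀ x y, p x → p y → p (x * y))
    (x : ↥(A₁ ⊔ A₂)) : p x := by
  have one : p 1 := left 1 (one_mem A₁)
  refine star_adjoin_induction (s := (A₁ : Set R) ∪ A₂) ?_ ?_ ?_ ?_ one ?_ add mul x
  · exact sup_le (fun x hx => StarAlgebra.subset_adjoin ℂ _ (Or.inl hx))
      (fun x hx => StarAlgebra.subset_adjoin ℂ _ (Or.inr hx))
  · exact Set.union_subset (SetLike.coe_subset_coe.mpr le_sup_left)
      (SetLike.coe_subset_coe.mpr le_sup_right)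
  · rintro x (hx | hx)
    · exact left x hx
    · exact right x hx
  · rintro x (hx | hx)
    · exact left _ (star_mem (s := A₁) hx)
    · exact right _ (star_mem (s := A₂) hx)
  · intro c x hx
    have := mul (c • 1) x (left _ (A₁.smul_mem (one_mem A₁) c)) hx
    rwa [smul_one_mul] at this

theorem adjoinU_induction {A : StarSubalgebra ℂ R} {U : R} {p : ↥(adjoinU A U) → Prop}
    (base : ∀ x : ↥(adjoinU A U), (x : R) ∈ A → p x)
    (gen : ∀ u : ↥(adjoinU A U), (u : R) = U → p u ∧ p (star u))
    (add : ∀ x y, p x → p y → p (x + y)) (mul : ∀ x y, p x → p y → p (x * y))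
    (x : ↥(adjoinU A U)) : p x := by
  have one : p 1 := base 1 (one_mem A)
  have hU : U ∈ adjoinU A U :=
    StarSubalgebra.mem_sup_right (StarAlgebra.subset_adjoin ℂ _ (Set.mem_singleton U))
  refine star_adjoin_induction (s := (A : Set R) ∪ {U}) ?_ ?_ ?_ ?_ one ?_ add mul x
  · refine sup_le (fun x hx => StarAlgebra.subset_adjoin ℂ _ (Or.inl hx)) ?_
    exact StarAlgebra.adjoin_le fun x hx => StarAlgebra.subset_adjoin ℂ _ (Or.inr hx)
  · refine Set.union_subset (SetLike.coe_subset_coe.mpr le_sup_left) ?_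
    exact Set.singleton_subset_iff.mpr hU
  · rintro x (hx | hx)
    · exact base x hx
    · exact (gen x hx).1
  · rintro x (hx | hx)
    · exact base _ (star_mem (s := A) hx)
    · exact (gen x hx).2
  · intro c x hx
    have := mul (c • 1) x (base _ (A.smul_mem (one_mem A) c)) hx
    rwa [smul_one_mul] at this

theorem IsLiberationDer.unique {A₁ A₂ : StarSubalgebra ℂ R}
    {δ δ' : ↥(A₁ ⊔ A₂) →ₗ[ℂ] AmalgTensor S (A₁ ⊔ A₂)} (h : IsLiberationDer S A₁ A₂ δ)
    (h' : IsLiberationDer S A₁ A₂ δ') : δ = δ' := by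
  ext1 x
  refine sup_induction (p := fun x => δ x = δ' x) (fun x hx => ?_) (fun x hx => ?_)
    (fun x y hx hy => ?_) (fun x y hx hy => ?_) x
  · rw [h.2.1 x hx, h'.2.1 x hx]
  · rw [h.2.2 x hx, h'.2.2 x hx]
  · rw [map_add, map_add, hx, hy]
  · rw [h.1, h'.1, hx, hy]

theorem IsUnitaryDer.unique {A : StarSubalgebra ℂ R} {U : R}
    {d d' : ↥(adjoinU A U) →ₗ[ℂ] AmalgTensor S (adjoinU A U)} (h : IsUnitaryDer S A U d)
    (h' : IsUnitaryDer S A U d') : d = d' := by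
  ext1 x
  refine adjoinU_induction (p := fun x => d x = d' x) (fun x hx => ?_) (fun x hx => ⟨?_, ?_⟩)
    (fun x y hx hy => ?_) (fun x y hx hy => ?_) x
  · rw [h.2.2 x hx, h'.2.2 x hx]
  · rw [(h.2.1 x hx).1, (h'.2.1 x hx).1]
  · rw [(h.2.1 x hx).2, (h'.2.1 x hx).2]
  · rw [map_add, map_add, hx, hy]
  · rw [h.1, h'.1, hx, hy]

/-- The set of elements that `D` maps into the range of `P ⊗_S P` is closed under products. -/
theorem IsDerivation.mul_mem_range (hSP : S ≤ P) (hPN : P ≤ N) {D : N →ₗ[ℂ] AmalgTensor S N}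
    (hD : IsDerivation D) (x y : P)
    (hx : D (StarSubalgebra.inclusion hPN x) ∈ LinearMap.range (tensorIncl hSP hPN))
    (hy : D (StarSubalgebra.inclusion hPN y) ∈ LinearMap.range (tensorIncl hSP hPN)) :
    D (StarSubalgebra.inclusion hPN (x * y)) ∈ LinearMap.range (tensorIncl hSP hPN) := by
  obtain ⟨s, hs⟩ := hx
  obtain ⟨t, ht⟩ := hy
  refine ⟨lact S x t + ract S y s, ?_⟩
  rw [_root_.map_mul, hD, map_add, tensorIncl_lact, tensorIncl_ract, hs, ht]

/-- If `P ⊗_S P → N ⊗_S N` is injective, then a derivation of `N` which maps `P` into the image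
of `P ⊗_S P` restricts to a derivation of `P`. -/
theorem IsDerivation.exists_restrict (hSP : S ≤ P) (hPN : P ≤ N)
    (hinj : Function.Injective (tensorIncl hSP hPN)) {D : N →ₗ[ℂ] AmalgTensor S N}
    (hD : IsDerivation D)
    (hrange : ∀ x : P,
      D (StarSubalgebra.inclusion hPN x) ∈ LinearMap.range (tensorIncl hSP hPN)) :
    ∃ d : P →ₗ[ℂ] AmalgTensor S P, IsDerivation d ∧
      ∀ x, tensorIncl hSP hPN (d x) = D (StarSubalgebra.inclusion hPN x) := by
  choose d hd using hrange
  refine ⟨⟨⟨d, fun x y => hinj ?_⟩, fun c x => hinj ?_⟩, fun x y => hinj ?_, hd⟩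
  · rw [hd, map_add, map_add, map_add, hd, hd]
  · change _ = tensorIncl hSP hPN (c • d x)
    rw [hd, map_smul, map_smul, map_smul, hd]
  · change tensorIncl hSP hPN (d (x * y)) = tensorIncl hSP hPN (lact S x (d y) + ract S y (d x))
    rw [hd, _root_.map_mul, hD, map_add, tensorIncl_lact, tensorIncl_ract, hd, hd]

/-- The representation of `P` on `(N ⊗_S N) × N` by upper triangular matrices associated with a
derivation of `P` with values in `N ⊗_S N`. -/
def triangularRep (hPN : P ≤ N) (D : P →ₗ[ℂ] AmalgTensor S N)
    (hD : ∀ a b, D (a * b) = lact S (StarSubalgebra.inclusion hPN a) (D b) +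
      ract S (StarSubalgebra.inclusion hPN b) (D a)) :
    P →ₐ[ℂ] Module.End ℂ (AmalgTensor S N × N) :=
  have hD1 : D 1 = 0 := by
    have h := hD 1 1
    rw [_root_.map_one, lact_one, ract_one, mul_one] at h
    exact left_eq_add.mp h
  AlgHom.ofLinearMap
    { toFun := fun a =>
        { toFun := fun v => (lact S (StarSubalgebra.inclusion hPN a) v.1 + ract S v.2 (D a),
            StarSubalgebra.inclusion hPN a * v.2)
          map_add' := fun v w => by
            refine Prod.ext ?_ ?_
            · simp only [Prod.fst_add, Prod.snd_add, map_add, ract_add, LinearMap.add_apply]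
              abel
            · simp [mul_add]
          map_smul' := fun c v => by
            refine Prod.ext ?_ ?_
            · simp [ract_smul]
            · simp }
      map_add' := fun a b => by
        refine LinearMap.ext fun v => ?_
        refine Prod.ext ?_ ?_
        · simp only [LinearMap.coe_mk, AddHom.coe_mk, LinearMap.add_apply, Prod.fst_add, map_add,
            lact_add]
          abel
        · change StarSubalgebra.inclusion hPN (a + b) * v.2 = _
          rw [map_add, add_mul]
          rfl
      map_smul' := fun c a => by
        refine LinearMap.ext fun v => ?_
        refine Prod.ext ?_ ?_
        · simp [lact_smul]
        · simp }
    (by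
      refine LinearMap.ext fun v => ?_
      refine Prod.ext ?_ ?_
      · change lact S (StarSubalgebra.inclusion hPN 1) v.1 + ract S v.2 (D 1) = v.1
        rw [hD1, map_zero, add_zero, _root_.map_one, lact_one]
      · change StarSubalgebra.inclusion hPN 1 * v.2 = v.2
        rw [_root_.map_one, one_mul])
    (fun a b => by
      refine LinearMap.ext fun v => ?_
      refine Prod.ext ?_ ?_
      · simp only [LinearMap.coe_mk, AddHom.coe_mk, Module.End.mul_apply, hD, _root_.map_mul,
          lact_mul, map_add, lact_ract, ract_mul]
        abel
      · change StarSubalgebra.inclusion hPN (a * b) * v.2 =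
          StarSubalgebra.inclusion hPN a * (StarSubalgebra.inclusion hPN b * v.2)
        rw [_root_.map_mul, mul_assoc])

theorem triangularRep_apply (hPN : P ≤ N) (D : P →ₗ[ℂ] AmalgTensor S N) (hD) (a : P)
    (v : AmalgTensor S N × N) :
    triangularRep hPN D hD a v = (lact S (StarSubalgebra.inclusion hPN a) v.1 + ract S v.2 (D a),
      StarSubalgebra.inclusion hPN a * v.2) := rfl

/-- Derivations of two algebras which are free with amalgamation over `S` extend to the algebra
they generate if they agree on `S`. -/
theorem AlgFreeOver.exists_derivation {A₁ A₂ : StarSubalgebra ℂ R} (h : AlgFreeOver S A₁ A₂)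
    (D₁ : A₁ →ₗ[ℂ] AmalgTensor S (A₁ ⊔ A₂)) (D₂ : A₂ →ₗ[ℂ] AmalgTensor S (A₁ ⊔ A₂))
    (hD₁ : ∀ a b, D₁ (a * b) = lact S (StarSubalgebra.inclusion le_sup_left a) (D₁ b) +
      ract S (StarSubalgebra.inclusion le_sup_left b) (D₁ a))
    (hD₂ : ∀ a b, D₂ (a * b) = lact S (StarSubalgebra.inclusion le_sup_right a) (D₂ b) +
      ract S (StarSubalgebra.inclusion le_sup_right b) (D₂ a))
    (hD : ∀ (s : R) (h₁ : s ∈ A₁) (h₂ : s ∈ A₂), s ∈ S → D₁ ⟨s, h₁⟩ = D₂ ⟨s, h₂⟩) :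
    ∃ D : ↥(A₁ ⊔ A₂) →ₗ[ℂ] AmalgTensor S (A₁ ⊔ A₂), IsDerivation D ∧
      (∀ a, D (StarSubalgebra.inclusion le_sup_left a) = D₁ a) ∧
      ∀ a, D (StarSubalgebra.inclusion le_sup_right a) = D₂ a := by
  obtain ⟨φ, hφ₁, hφ₂⟩ := h.2.2 _ (triangularRep le_sup_left D₁ hD₁)
    (triangularRep le_sup_right D₂ hD₂) (by
      intro s h₁ h₂ hs
      refine LinearMap.ext fun v => ?_
      rw [triangularRep_apply, triangularRep_apply, hD s h₁ h₂ hs]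
      rfl)
  -- `D` is the off-diagonal corner of the representation, read off at the vector `(0, 1)`.
  let D : ↥(A₁ ⊔ A₂) →ₗ[ℂ] AmalgTensor S (A₁ ⊔ A₂) :=
    (LinearMap.fst ℂ _ _) ∘ₗ (LinearMap.applyₗ (0, 1)) ∘ₗ φ.toLinearMap
  have hDφ : ∀ x, D x = (φ x (0, 1)).1 := fun x => rfl
  have h₁ : ∀ a, D (StarSubalgebra.inclusion le_sup_left a) = D₁ a := by
    intro a
    rw [hDφ, hφ₁, triangularRep_apply]
    simp [ract_one]
  have h₂ : ∀ a, D (StarSubalgebra.inclusion le_sup_right a) = D₂ a := by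
    intro a
    rw [hDφ, hφ₂, triangularRep_apply]
    simp [ract_one]
  -- The triangular form passes from the generators to all of `A₁ ∨ A₂`. Multiplicativity of `φ` is
  -- then the Leibniz rule for `D`.
  have hφ : ∀ x v, φ x v = (lact S x v.1 + ract S v.2 (D x), x * v.2) := by
    intro x
    refine sup_induction (p := fun x => ∀ v, φ x v = (lact S x v.1 + ract S v.2 (D x), x * v.2))
      (fun x hx v => ?_) (fun x hx v => ?_) (fun x y hx hy v => ?_) (fun x y hx hy v => ?_) x
    · obtain ⟨a, rfl⟩ : ∃ a : A₁, x = StarSubalgebra.inclusion le_sup_left a := ⟨⟨x, hx⟩, rfl⟩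
      rw [h₁, hφ₁, triangularRep_apply]
    · obtain ⟨a, rfl⟩ : ∃ a : A₂, x = StarSubalgebra.inclusion le_sup_right a := ⟨⟨x, hx⟩, rfl⟩
      rw [h₂, hφ₂, triangularRep_apply]
    · rw [map_add, LinearMap.add_apply, hx, hy, map_add, lact_add]
      refine Prod.ext ?_ ?_
      · simp only [Prod.fst_add, map_add, LinearMap.add_apply]
        abel
      · simp [add_mul]
    · have hDxy : D (x * y) = lact S x (D y) + ract S y (D x) := by
        rw [hDφ, _root_.map_mul, Module.End.mul_apply, hy, hx]
        simp [ract_one]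
      rw [_root_.map_mul, Module.End.mul_apply, hy, hx, hDxy]
      refine Prod.ext ?_ ?_
      · simp only [map_add, lact_mul, lact_ract, ract_mul]
        abel
      · simp [mul_assoc]
  refine ⟨D, fun x y => ?_, h₁, h₂⟩
  rw [hDφ, _root_.map_mul, Module.End.mul_apply, hφ y, hφ x]
  simp [ract_one]

end Algebraic

/-! ### Injectivity of relative tensor products over W*-subalgebras -/

/-- Replace `y` by `q y` and move `q` across the tensor sign, where it annihilates the row `x`. -/
theorem sum_tmk_eq_zero {R : Type u} [Ring R] [StarRing R] [Algebra ℂ R] [StarModule ℂ R]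
    {S P : StarSubalgebra ℂ R} {I : Type*} [Fintype I] (x y : I → P) (q : I → I → P)
    (hq : ∀ i j, (q i j : R) ∈ S) (hxq : ∀ k, ∑ i, x i * q i k = 0)
    (hqy : ∀ i, ∑ j, q i j * y j = y i) : ∑ i, tmk S (x i) (y i) = 0 := by
  calc ∑ i, tmk S (x i) (y i) = ∑ i, ∑ j, tmk S (x i * q i j) (y j) := by
        refine Finset.sum_congr rfl fun i _ => ?_
        conv_lhs => rw [← hqy i]
        rw [tmk_eq, map_sum]
        exact Finset.sum_congr rfl fun j _ => (tmk_balanced _ _ _ (hq i j)).symm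
    _ = ∑ j, ∑ i, tmk S (x i * q i j) (y j) := Finset.sum_comm
    _ = 0 := Finset.sum_eq_zero fun j _ => by
        simp only [tmk_eq]
        rw [← LinearMap.sum_apply, ← map_sum, hxq, map_zero, LinearMap.zero_apply]

section Injectivity

variable {H : Type u} [NormedAddCommGroup H] [InnerProductSpace ℂ H] [CompleteSpace H]
variable {M : VonNeumannAlgebra H} {τ : Elt M →ₗ[ℂ] ℂ}

/-- The bilinear map `(x, y) ↦ E_S(k x) y`. -/
def expBilin (τ : Elt M →ₗ[ℂ] ℂ) (S N : StarSubalgebra ℂ (Elt M)) (k : Elt M) :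
    N →ₗ[ℂ] N →ₗ[ℂ] Elt M :=
  (LinearMap.mul ℂ (Elt M)).compl₁₂
    (condExp τ S ∘ₗ LinearMap.mulLeft ℂ k ∘ₗ N.subtype.toAlgHom.toLinearMap)
    N.subtype.toAlgHom.toLinearMap

theorem expBilin_apply (S N : StarSubalgebra ℂ (Elt M)) (k : Elt M) (x y : N) :
    expBilin τ S N k x y = condExp τ S (k * x) * (y : Elt M) := rfl

theorem balancedRel_le_ker (S N : StarSubalgebra ℂ (Elt M)) (k : Elt M) :
    balancedRel S N ≤ LinearMap.ker (TensorProduct.lift (expBilin τ S N k)) := by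
  rw [balancedRel, Submodule.span_le]
  rintro _ ⟨x, y, b, hb, rfl⟩
  rw [SetLike.mem_coe, LinearMap.mem_ker, map_sub, TensorProduct.lift.tmul,
    TensorProduct.lift.tmul, expBilin_apply, expBilin_apply, sub_eq_zero, MulMemClass.coe_mul,
    MulMemClass.coe_mul, ← mul_assoc, (condExp_bimodule τ S _ _ hb).1, mul_assoc]

/-- The map `x ⊗ y ↦ E_S(k x) y` on `N ⊗_S N`. -/
def expPairing (τ : Elt M →ₗ[ℂ] ℂ) (S N : StarSubalgebra ℂ (Elt M)) (k : Elt M) :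
    AmalgTensor S N →ₗ[ℂ] Elt M :=
  Submodule.liftQ _ (TensorProduct.lift (expBilin τ S N k)) (balancedRel_le_ker S N k)

theorem expPairing_tensorIncl_sum {S P N : StarSubalgebra ℂ (Elt M)} (hSP : S ≤ P) (hPN : P ≤ N)
    (k : Elt M) {I : Type*} [Fintype I] (x y : I → P) :
    expPairing τ S N k (tensorIncl hSP hPN (∑ i, tmk S (x i) (y i))) =
      ∑ i, condExp τ S (k * x i) * (y i : Elt M) :=
  map_sum ((expPairing τ S N k).comp (tensorIncl hSP hPN)) (fun i => tmk S (x i) (y i)) _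

theorem coe_sum_mul {I : Type*} [Fintype I] (a b : I → Elt M) :
    ((∑ i, a i * b i : Elt M) : H →L[ℂ] H) = ∑ i, (a i : H →L[ℂ] H) * (b i : H →L[ℂ] H) := by
  rw [AddSubmonoidClass.coe_finsetSum]
  rfl

theorem exists_kernel_matrix_mem {S : StarSubalgebra ℂ (Elt M)} (hS : wStar S ≤ S) {I : Type*}
    [Fintype I] (G : I → I → Elt M) (hG : ∀ i j, G i j ∈ S) :
    ∃ q : I → I → Elt M, (∀ i j, q i j ∈ S) ∧ (∀ i k, ∑ j, G i j * q j k = 0) ∧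
      ∀ y : I → Elt M, (∀ i, ∑ j, G i j * y j = 0) → ∀ i, ∑ j, q i j * y j = y i := by
  obtain ⟨p, hp, hGp, hker⟩ := exists_kernel_matrix (S.map M.toStarSubalgebra.subtype)
    (fun i j => (G i j : H →L[ℂ] H)) (fun i j s hs =>
      (mem_wStar_iff S _).mp (le_wStar S (hG i j)) s fun a ha => hs _ ⟨a, ha, rfl⟩)
  choose q hqS hqp using fun i j => exists_mem_of_commute hS (p i j) fun s hs =>
    hp i j s (by rintro _ ⟨a, ha, rfl⟩; exact hs a ha)
  simp only [← hqp] at hGp hker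
  refine ⟨q, hqS, fun i k => Subtype.ext ?_, fun w hw i => Subtype.ext ?_⟩
  · rw [coe_sum_mul]
    exact hGp i k
  · rw [coe_sum_mul]
    refine hker (fun j => (w j : H →L[ℂ] H)) (fun i => ?_) i
    rw [← coe_sum_mul, hw i]
    rfl

/-- The support projection of a row of elements of `M` with respect to the `S`-valued inner
product `E_S(x* y)`. -/
theorem IsTraceState.exists_annihilator (hτ : IsTraceState τ) {S : StarSubalgebra ℂ (Elt M)}
    (hS : wStar S ≤ S) {I : Type*} [Fintype I] (x : I → Elt M) :
    ∃ q : I → I → Elt M, (∀ i j, q i j ∈ S) ∧ (∀ k, ∑ i, x i * q i k = 0) ∧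
      ∀ y : I → Elt M, (∀ k, ∑ i, condExp τ S (star (x k) * x i) * y i = 0) →
        ∀ i, ∑ j, q i j * y j = y i := by
  have hE := hτ.isCondExp_condExp hS
  obtain ⟨q, hqS, hGq, hq⟩ := exists_kernel_matrix_mem hS
    (fun i j => condExp τ S (star (x i) * x j)) (fun i j => hE.mem _)
  -- The element `z = ∑ x_i q_ik` satisfies `E_S(x_i* z) = 0` for every `i`, hence `E_S(z* z) = 0`,
  -- and faithfulness gives `z = 0`.
  refine ⟨q, hqS, fun k => hτ.faithful _ ?_, hq⟩
  rw [← hE.trace]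
  have h1 : ∀ i, condExp τ S (star (x i) * ∑ j, x j * q j k) = 0 := by
    intro i
    rw [Finset.mul_sum, map_sum, ← hGq i k]
    refine Finset.sum_congr rfl fun j _ => ?_
    rw [← mul_assoc, hE.mul_right _ (hqS j k)]
  rw [star_sum, Finset.sum_mul, map_sum, Finset.sum_eq_zero, map_zero]
  intro j _
  rw [star_mul, mul_assoc, hE.mul_left _ (star_mem (hqS j k)), h1, mul_zero]

/-- Subalgebras of `M` are flat over a W*-subalgebra `S`, in the form of the injectivity of
`P ⊗_S P → N ⊗_S N`. -/
theorem IsTraceState.tensorIncl_injective (hτ : IsTraceState τ) {S P N : StarSubalgebra ℂ (Elt M)}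
    (hS : wStar S ≤ S) (hSP : S ≤ P) (hPN : P ≤ N) :
    Function.Injective (tensorIncl hSP hPN) := by
  rw [injective_iff_map_eq_zero]
  intro t ht
  obtain ⟨I, x, y, hI, rfl⟩ : ∃ (I : Type u) (x y : I → P) (_ : Fintype I),
      t = ∑ i, tmk S (x i) (y i) := by
    obtain ⟨z, rfl⟩ := Submodule.mkQ_surjective _ t
    obtain ⟨I, rfl⟩ := TensorProduct.exists_finset z
    refine ⟨I, fun i => i.1.1, fun i => i.1.2, inferInstance, ?_⟩
    rw [← Finset.sum_coe_sort, map_sum]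
    rfl
  obtain ⟨q, hqS, hxq, hq⟩ := hτ.exists_annihilator hS fun i => (x i : Elt M)
  let q' : I → I → P := fun i j => ⟨q i j, hSP (hqS i j)⟩
  have hxq' : ∀ k, ∑ i, x i * q' i k = 0 := by
    intro k
    refine Subtype.ext ?_
    rw [AddSubmonoidClass.coe_finsetSum]
    exact hxq k
  have hqy : ∀ i, ∑ j, q' i j * y j = y i := by
    intro i
    refine Subtype.ext ?_
    rw [AddSubmonoidClass.coe_finsetSum]
    refine hq (fun j => (y j : Elt M)) (fun k => ?_) i
    -- The Gram equations for `y` are values of the pairing on `N ⊗_S N`, so they follow from the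
    -- vanishing of the image of `t` there.
    rw [← expPairing_tensorIncl_sum hSP hPN, ht, map_zero]
  exact sum_tmk_eq_zero x y q' hqS hxq' hqy

end Injectivity

/-! ### Alternating centered words -/

section Words

variable {R : Type u} [Ring R] [StarRing R] [Algebra ℂ R] [StarModule ℂ R]
variable {e : R →ₗ[ℂ] R} {B P Q S N : StarSubalgebra ℂ R}

/-- `P` for `true` and `Q` for `false`. -/
def side (P Q : StarSubalgebra ℂ R) (i : Bool) : StarSubalgebra ℂ R := if i then P else Q

/-- `l` is an alternating word in the elements of `P` and `Q` annihilated by `e`. -/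
structure IsWord (e : R →ₗ[ℂ] R) (P Q : StarSubalgebra ℂ R) (l : List (Bool × R)) : Prop where
  chain : l.IsChain (fun p q => p.1 ≠ q.1)
  mem : ∀ p ∈ l, p.2 ∈ side P Q p.1 ∧ e p.2 = 0

/-- `e` is a `B`-bimodular projection onto `B`. -/
structure IsBimodProj (e : R →ₗ[ℂ] R) (B : StarSubalgebra ℂ R) : Prop where
  mem : ∀ x, e x ∈ B
  eq_self : ∀ n ∈ B, e n = n
  mul_left : ∀ n ∈ B, ∀ x, e (n * x) = n * e x
  mul_right : ∀ n ∈ B, ∀ x, e (x * n) = e x * n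

theorem IsBimodProj.sub_self (he : IsBimodProj e B) (x : R) : e (x - e x) = 0 := by
  rw [map_sub, he.eq_self _ (he.mem x), _root_.sub_self]

theorem IsWord.nil : IsWord e P Q [] := ⟨List.isChain_nil, by simp⟩

theorem IsWord.append_left {u l : List (Bool × R)} (h : IsWord e P Q (u ++ l)) : IsWord e P Q u :=
  ⟨h.chain.left_of_append, fun p hp => h.mem p (List.mem_append_left _ hp)⟩

theorem IsWord.append_right {u l : List (Bool × R)} (h : IsWord e P Q (u ++ l)) :
    IsWord e P Q l :=
  ⟨h.chain.right_of_append, fun p hp => h.mem p (List.mem_append_right _ hp)⟩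

theorem IsWord.tail {p : Bool × R} {l : List (Bool × R)} (h : IsWord e P Q (p :: l)) :
    IsWord e P Q l := IsWord.append_right (u := [p]) h

theorem IsWord.replace_head {i : Bool} {a a' : R} {l : List (Bool × R)}
    (h : IsWord e P Q ((i, a) :: l)) (hmem : a' ∈ side P Q i) (h0 : e a' = 0) :
    IsWord e P Q ((i, a') :: l) := by
  refine ⟨?_, ?_⟩
  · have := h.chain
    rw [List.isChain_cons] at this ⊢
    exact this
  · intro p hp
    rcases List.mem_cons.mp hp with rfl | hp
    · exact ⟨hmem, h0⟩
    · exact h.mem p (List.mem_cons_of_mem _ hp)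

theorem IsWord.replace_last {i : Bool} {a a' : R} {l : List (Bool × R)}
    (h : IsWord e P Q (l ++ [(i, a)])) (hmem : a' ∈ side P Q i) (h0 : e a' = 0) :
    IsWord e P Q (l ++ [(i, a')]) := by
  refine ⟨?_, ?_⟩
  · have := h.chain
    rw [List.isChain_append] at this ⊢
    refine ⟨this.1, List.isChain_singleton _, fun x hx y hy => ?_⟩
    have h3 := this.2.2 x hx (i, a) (by simp)
    simp at hy
    rw [← hy]
    exact h3
  · intro p hp
    rcases List.mem_append.mp hp with hp | hp
    · exact h.mem p (List.mem_append_left _ hp)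
    · rw [List.mem_singleton] at hp
      subst hp
      exact ⟨hmem, h0⟩

theorem IsWord.cons {i j : Bool} {a b : R} {l : List (Bool × R)}
    (h : IsWord e P Q ((j, b) :: l)) (hij : i ≠ j) (hmem : a ∈ side P Q i) (h0 : e a = 0) :
    IsWord e P Q ((i, a) :: (j, b) :: l) := by
  refine ⟨List.isChain_cons_cons.mpr ⟨hij, h.chain⟩, ?_⟩
  intro p hp
  rcases List.mem_cons.mp hp with rfl | hp
  · exact ⟨hmem, h0⟩
  · exact h.mem p hp

theorem IsWord.concat {i j : Bool} {a b : R} {l : List (Bool × R)}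
    (h : IsWord e P Q (l ++ [(j, b)])) (hij : j ≠ i) (hmem : a ∈ side P Q i) (h0 : e a = 0) :
    IsWord e P Q (l ++ [(j, b)] ++ [(i, a)]) := by
  refine ⟨?_, ?_⟩
  · rw [List.isChain_append]
    refine ⟨h.chain, List.isChain_singleton _, fun x hx y hy => ?_⟩
    simp at hx hy
    rw [← hx, ← hy]
    exact hij
  · intro p hp
    rcases List.mem_append.mp hp with hp | hp
    · exact h.mem p hp
    · rw [List.mem_singleton] at hp
      subst hp
      exact ⟨hmem, h0⟩

theorem IsWord.singleton {i : Bool} {a : R} (hmem : a ∈ side P Q i) (h0 : e a = 0) :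
    IsWord e P Q [(i, a)] :=
  ⟨List.isChain_singleton _, by
    intro p hp
    rw [List.mem_singleton] at hp
    subst hp
    exact ⟨hmem, h0⟩⟩

/-- The linear span of `B` and of the alternating centered words. -/
def wordSpan (e : R →ₗ[ℂ] R) (B P Q : StarSubalgebra ℂ R) : Submodule ℂ R :=
  Submodule.span ℂ ((B : Set R) ∪ {w | ∃ l, IsWord e P Q l ∧ w = (l.map Prod.snd).prod})

theorem mem_wordSpan_of_mem {b : R} (hb : b ∈ B) : b ∈ wordSpan e B P Q :=
  Submodule.subset_span (Or.inl hb)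

theorem IsWord.mem_wordSpan {l : List (Bool × R)} (hl : IsWord e P Q l) :
    (l.map Prod.snd).prod ∈ wordSpan e B P Q :=
  Submodule.subset_span (Or.inr ⟨l, hl, rfl⟩)

theorem le_side (hP : B ≤ P) (hQ : B ≤ Q) (i : Bool) : B ≤ side P Q i := by
  cases i
  · exact hQ
  · exact hP

theorem IsBimodProj.base_mul_word (he : IsBimodProj e B) (hP : B ≤ P) (hQ : B ≤ Q) {b : R}
    (hb : b ∈ B) {l : List (Bool × R)} (hl : IsWord e P Q l) :
    b * (l.map Prod.snd).prod ∈ wordSpan e B P Q := by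
  match l, hl with
  | [], _ => simpa using mem_wordSpan_of_mem hb
  | (k, c) :: l, hl =>
    have hc := hl.mem (k, c) (by simp)
    have := (hl.replace_head (a' := b * c) (mul_mem (le_side hP hQ k hb) hc.1)
      (by rw [he.mul_left b hb, hc.2, mul_zero])).mem_wordSpan (B := B)
    simpa [mul_assoc] using this

/-- If the first letter lies on the same side as `x`, it is merged with `x` and the product is
recentered. Otherwise the centered part of `x` becomes a new first letter. The part in `B` is
absorbed by the remaining word. -/
theorem IsBimodProj.side_mul_word (he : IsBimodProj e B) (hP : B ≤ P) (hQ : B ≤ Q) {i : Bool}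
    {x : R} (hx : x ∈ side P Q i) {l : List (Bool × R)} (hl : IsWord e P Q l) :
    x * (l.map Prod.snd).prod ∈ wordSpan e B P Q := by
  have hcent : ∀ z ∈ side P Q i, z - e z ∈ side P Q i := fun z hz =>
    sub_mem hz (le_side hP hQ i (he.mem z))
  have hsplit : ∀ z w : R, z * w = e z * w + (z - e z) * w := fun z w => by
    rw [sub_mul, add_sub_cancel]
  match l, hl with
  | [], hl =>
    have h1 := (IsWord.singleton (hcent x hx) (he.sub_self x)).mem_wordSpan (B := B)
    have h2 : e x ∈ wordSpan e B P Q := mem_wordSpan_of_mem (he.mem x)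
    have := add_mem h2 h1
    simpa using this
  | (j, a) :: l, hl =>
    have ha := hl.mem (j, a) (by simp)
    by_cases hij : i = j
    · subst hij
      have hxa : x * a ∈ side P Q i := mul_mem hx ha.1
      have h1 := (hl.replace_head (hcent _ hxa) (he.sub_self _)).mem_wordSpan (B := B)
      have h2 := he.base_mul_word hP hQ (he.mem (x * a)) hl.tail
      have := add_mem h2 h1
      simp only [List.map_cons, List.prod_cons] at this ⊢
      rwa [← mul_assoc, hsplit (x * a)]
    · have h1 := (hl.cons hij (hcent x hx) (he.sub_self x)).mem_wordSpan (B := B)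
      have h2 := he.base_mul_word hP hQ (he.mem x) hl
      have := add_mem h2 h1
      simp only [List.map_cons, List.prod_cons] at this ⊢
      rwa [hsplit x]

theorem IsBimodProj.side_mul_mem (he : IsBimodProj e B) (hP : B ≤ P) (hQ : B ≤ Q) {i : Bool}
    {x : R} (hx : x ∈ side P Q i) {w : R} (hw : w ∈ wordSpan e B P Q) :
    x * w ∈ wordSpan e B P Q := by
  have h : wordSpan e B P Q ≤ (wordSpan e B P Q).comap (LinearMap.mulLeft ℂ x) := by
    refine Submodule.span_le.mpr ?_
    rintro w (hw | ⟨l, hl, rfl⟩)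
    · have := he.side_mul_word hP hQ (mul_mem hx (le_side hP hQ i hw)) IsWord.nil
      simpa using this
    · exact he.side_mul_word hP hQ hx hl
  exact h hw

theorem IsBimodProj.sup_le_wordSpan (he : IsBimodProj e B) (hP : B ≤ P) (hQ : B ≤ Q) {x : R}
    (hx : x ∈ P ⊔ Q) : x ∈ wordSpan e B P Q := by
  have h := sup_induction (A₁ := P) (A₂ := Q)
    (p := fun x => ∀ w ∈ wordSpan e B P Q, (x : R) * w ∈ wordSpan e B P Q)
    (fun x hx w hw => he.side_mul_mem hP hQ (i := true) hx hw)
    (fun x hx w hw => he.side_mul_mem hP hQ (i := false) hx hw)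
    (fun x y hx hy w hw => by
      have := add_mem (hx w hw) (hy w hw)
      rwa [← add_mul] at this)
    (fun x y hx hy w hw => by
      have := hx _ (hy w hw)
      rwa [← mul_assoc] at this) ⟨x, hx⟩ 1 (mem_wordSpan_of_mem (one_mem B))
  rwa [mul_one] at h

/-- `P ∨ Q` is spanned by `P` and by the alternating centered words with a letter in `Q`. -/
theorem IsBimodProj.mem_span_word (he : IsBimodProj e B) (hP : B ≤ P) (hQ : B ≤ Q) {x : R}
    (hx : x ∈ P ⊔ Q) : x ∈ Submodule.span ℂ ((P : Set R) ∪
      {w | ∃ l, IsWord e P Q l ∧ (∃ c, (false, c) ∈ l) ∧ w = (l.map Prod.snd).prod}) := by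
  refine Submodule.span_mono ?_ (he.sup_le_wordSpan hP hQ hx)
  rintro w (hw | ⟨l, hl, rfl⟩)
  · exact Or.inl (hP hw)
  · by_cases hc : ∃ c, (false, c) ∈ l
    · exact Or.inr ⟨l, hl, hc, rfl⟩
    · refine Or.inl (list_prod_mem (S := P) fun y hy => ?_)
      obtain ⟨⟨i, y⟩, hp, rfl⟩ := List.mem_map.mp hy
      cases i
      · exact absurd ⟨y, hp⟩ hc
      · exact (hl.mem _ hp).1

theorem IsWord.prod_mem (hPN : P ≤ N) (hQN : Q ≤ N) {l : List (Bool × R)} (hl : IsWord e P Q l) :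
    (l.map Prod.snd).prod ∈ N := by
  refine list_prod_mem (S := N) fun y hy => ?_
  obtain ⟨⟨i, y⟩, hp, rfl⟩ := List.mem_map.mp hy
  have := (hl.mem _ hp).1
  cases i
  · exact hQN this
  · exact hPN this

/-- A last letter in `Q` lets the centered part of `y` be appended. A last letter in `P` is merged
with `y` and recentered, and the remaining prefix is nonempty because it still holds the letter in
`Q`. -/
theorem IsBimodProj.word_mul_eq_zero (he : IsBimodProj e B) (hP : B ≤ P)
    (hfree : ∀ l, IsWord e P Q l → l ≠ [] → e (l.map Prod.snd).prod = 0)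
    {l : List (Bool × R)} (hl : IsWord e P Q l) (hc : ∃ c, (false, c) ∈ l) {y : R} (hy : y ∈ P) :
    e ((l.map Prod.snd).prod * y) = 0 := by
  have hcent : ∀ z ∈ P, z - e z ∈ side P Q true := fun z hz => sub_mem hz (hP (he.mem z))
  have hsplit : ∀ w z : R, w * z = w * e z + w * (z - e z) := fun w z => by
    rw [mul_sub, add_sub_cancel]
  rcases List.eq_nil_or_concat l with rfl | ⟨l, ⟨i, a⟩, rfl⟩
  · simp at hc
  rw [List.concat_eq_append] at hl hc ⊢
  cases i
  · have h1 := hfree _ (hl.concat (i := true) (by simp) (hcent y hy) (he.sub_self y)) (by simp)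
    rw [hsplit, map_add, he.mul_right _ (he.mem y), hfree _ hl (by simp), zero_mul, zero_add]
    simpa [mul_assoc] using h1
  · have ha : a ∈ P := (hl.mem (true, a) (by simp)).1
    have hne : l ≠ [] := by
      rintro rfl
      simp at hc
    have h1 := hfree _ (hl.replace_last (hcent _ (mul_mem ha hy)) (he.sub_self _)) (by simp)
    have h2 := hfree _ hl.append_left hne
    have h3 : ((l ++ [(true, a)]).map Prod.snd).prod * y = (l.map Prod.snd).prod * (a * y) := by
      simp [mul_assoc]
    rw [h3, hsplit, map_add, he.mul_right _ (he.mem _), h2, zero_mul, zero_add]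
    simpa using h1

/-! ### Compatibility of derivations with conditional expectations -/

variable {f : N →ₗ[ℂ] P}
  {hf : ∀ x b : N, (b : R) ∈ S →
      (f (x * b) : R) = (f x : R) * (b : R) ∧ (f (b * x) : R) = (b : R) * (f x : R)}

theorem tensorMap_tensorIncl (hSP : S ≤ P) (hPN : P ≤ N)
    (hid : ∀ x, f (StarSubalgebra.inclusion hPN x) = x) (t : AmalgTensor S P) :
    tensorMap hSP f hf (tensorIncl hSP hPN t) = t :=
  LinearMap.congr_fun (f := tensorMap hSP f hf ∘ₗ tensorIncl hSP hPN) (g := LinearMap.id)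
    (amalgTensor_hom_ext fun x y => by
      change tmk S (f (StarSubalgebra.inclusion hPN x)) (f (StarSubalgebra.inclusion hPN y)) =
        tmk S x y
      rw [hid, hid]) t

/-- Bimodularity over `P` gives `f(v p) ⊗ f(q x) = f(v) p ⊗ q f(x)`. -/
theorem tensorMap_lact_ract_eq_zero (hSP : S ≤ P) (hPN : P ≤ N)
    (hl : ∀ (p : P) (x : N), f (StarSubalgebra.inclusion hPN p * x) = p * f x)
    (hr : ∀ (p : P) (x : N), f (x * StarSubalgebra.inclusion hPN p) = f x * p)
    {v x : N} (hvx : f v = 0 ∨ f x = 0) (t : AmalgTensor S P) :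
    tensorMap hSP f hf (lact S v (ract S x (tensorIncl hSP hPN t))) = 0 :=
  LinearMap.congr_fun
    (f := tensorMap hSP f hf ∘ₗ lact S v ∘ₗ ract S x ∘ₗ tensorIncl hSP hPN) (g := 0)
    (amalgTensor_hom_ext fun p q => by
      change tmk S (f (v * StarSubalgebra.inclusion hPN p))
        (f (StarSubalgebra.inclusion hPN q * x)) = 0
      rw [hl, hr]
      rcases hvx with h | h
      · rw [h, zero_mul, tmk_zero_left]
      · rw [h, mul_zero, tmk_zero_right]) t

/-- The prefix `u` collects the letters that the Leibniz rule has already passed. Keeping it in the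
statement lets the induction use a letter of `Q` on either side of the differentiated one. -/
theorem IsDerivation.tensorMap_word (hSP : S ≤ P) (hPN : P ≤ N) (hQN : Q ≤ N)
    (hl : ∀ (p : P) (x : N), f (StarSubalgebra.inclusion hPN p * x) = p * f x)
    (hr : ∀ (p : P) (x : N), f (x * StarSubalgebra.inclusion hPN p) = f x * p)
    (hword : ∀ l, IsWord e P Q l → (∃ c, (false, c) ∈ l) → ∀ x : N,
      (x : R) = (l.map Prod.snd).prod → f x = 0)
    {D : N →ₗ[ℂ] AmalgTensor S N} (hD : IsDerivation D) (hQ : ∀ x : N, (x : R) ∈ Q → D x = 0)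
    (hP : ∀ x : P, D (StarSubalgebra.inclusion hPN x) ∈ LinearMap.range (tensorIncl hSP hPN))
    (l u : List (Bool × R)) (hul : IsWord e P Q (u ++ l)) (hc : ∃ c, (false, c) ∈ u ++ l)
    (x v : N) (hx : (x : R) = (l.map Prod.snd).prod) (hv : (v : R) = (u.map Prod.snd).prod) :
    tensorMap hSP f hf (lact S v (D x)) = 0 := by
  induction l generalizing u x v with
  | nil =>
    have : x = 1 := Subtype.ext (by simpa using hx)
    rw [this, hD.map_one, map_zero, map_zero]
  | cons p l ih =>
    obtain ⟨i, a⟩ := p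
    have hal := hul.append_right
    have ha := (hal.mem (i, a) (by simp)).1
    have haN : a ∈ N := by
      cases i
      · exact hQN ha
      · exact hPN ha
    obtain ⟨x', hx'⟩ : ∃ x' : N, (x' : R) = (l.map Prod.snd).prod :=
      ⟨⟨_, hal.tail.prod_mem hPN hQN⟩, rfl⟩
    have hxa : x = ⟨a, haN⟩ * x' := Subtype.ext (by simp [hx, hx'])
    have h1 := ih (u ++ [(i, a)]) (by simpa using hul) (by simpa using hc) x' (v * ⟨a, haN⟩) hx'
      (by simp [hv])
    rw [hxa, hD, map_add, map_add, ← lact_mul, h1, zero_add]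
    cases i
    · rw [hQ ⟨a, haN⟩ ha, map_zero, map_zero, map_zero]
    · obtain ⟨t, ht⟩ := hP ⟨a, ha⟩
      change _ = D ⟨a, haN⟩ at ht
      rw [← ht]
      refine tensorMap_lact_ract_eq_zero hSP hPN hl hr ?_ t
      obtain ⟨c, hc⟩ := hc
      rcases List.mem_append.mp hc with hc | hc
      · exact Or.inl (hword u hul.append_left ⟨c, hc⟩ v hv)
      · rcases List.mem_cons.mp hc with hc | hc
        · simp at hc
        · exact Or.inr (hword l hal.tail ⟨c, hc⟩ x' hx')

theorem IsDerivation.tensorMap_comp (he : IsBimodProj e B) (hBP : B ≤ P) (hBQ : B ≤ Q)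
    (hSP : S ≤ P) (hPN : P ≤ N) (hQN : Q ≤ N) (hN : N ≤ P ⊔ Q)
    (hid : ∀ x, f (StarSubalgebra.inclusion hPN x) = x)
    (hl : ∀ (p : P) (x : N), f (StarSubalgebra.inclusion hPN p * x) = p * f x)
    (hr : ∀ (p : P) (x : N), f (x * StarSubalgebra.inclusion hPN p) = f x * p)
    (hword : ∀ l, IsWord e P Q l → (∃ c, (false, c) ∈ l) → ∀ x : N,
      (x : R) = (l.map Prod.snd).prod → f x = 0)
    {D : N →ₗ[ℂ] AmalgTensor S N} (hD : IsDerivation D) (hQ : ∀ x : N, (x : R) ∈ Q → D x = 0)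
    (hP : ∀ x : P, D (StarSubalgebra.inclusion hPN x) ∈ LinearMap.range (tensorIncl hSP hPN))
    (x : N) : tensorIncl hSP hPN (tensorMap hSP f hf (D x)) =
      D (StarSubalgebra.inclusion hPN (f x)) := by
  let L : N →ₗ[ℂ] AmalgTensor S N := tensorIncl hSP hPN ∘ₗ tensorMap hSP f hf ∘ₗ D -
    D ∘ₗ (StarSubalgebra.inclusion hPN).toAlgHom.toLinearMap ∘ₗ f
  have hL : ∀ x, L x = tensorIncl hSP hPN (tensorMap hSP f hf (D x)) -
    D (StarSubalgebra.inclusion hPN (f x)) := fun _ => rfl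
  have key : Submodule.span ℂ ((P : Set R) ∪
      {w | ∃ l, IsWord e P Q l ∧ (∃ c, (false, c) ∈ l) ∧ w = (l.map Prod.snd).prod}) ≤
      (LinearMap.ker L).map N.subtype.toAlgHom.toLinearMap := by
    rw [Submodule.span_le]
    rintro w (hw | ⟨l, hlw, hc, rfl⟩)
    · refine ⟨StarSubalgebra.inclusion hPN ⟨w, hw⟩, ?_, rfl⟩
      rw [SetLike.mem_coe, LinearMap.mem_ker, hL, hid]
      obtain ⟨t, ht⟩ := hP ⟨w, hw⟩
      rw [← ht, tensorMap_tensorIncl hSP hPN hid, sub_self]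
    · refine ⟨⟨_, hlw.prod_mem hPN hQN⟩, ?_, rfl⟩
      rw [SetLike.mem_coe, LinearMap.mem_ker, hL, hword l hlw hc _ rfl, map_zero, map_zero,
        sub_zero]
      have := hD.tensorMap_word (hf := hf) hSP hPN hQN hl hr hword hQ hP l [] hlw hc
        ⟨_, hlw.prod_mem hPN hQN⟩ 1 rfl (by simp)
      rw [lact_one] at this
      rw [this, map_zero]
  obtain ⟨y, hy, hyx⟩ := key (he.mem_span_word hBP hBQ (hN x.2))
  have hyx' : y = x := Subtype.ext hyx
  rw [hyx', SetLike.mem_coe, LinearMap.mem_ker, hL] at hy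
  exact sub_eq_zero.mp hy

end Words

/-! ### The conditional expectation as a coalgebra morphism -/

section Tracial

variable {H : Type u} [NormedAddCommGroup H] [InnerProductSpace ℂ H] [CompleteSpace H]
variable {M : VonNeumannAlgebra H} {τ : Elt M →ₗ[ℂ] ℂ} {S B P Q N : StarSubalgebra ℂ (Elt M)}

theorem IsCondExp.isBimodProj {E : Elt M →ₗ[ℂ] Elt M} (hE : IsCondExp τ B E) : IsBimodProj E B :=
  ⟨hE.mem, hE.eq_self, hE.mul_left, hE.mul_right⟩

/-- The word is trace orthogonal to `P` by freeness, and to `W*(P)` by normality. -/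
theorem IsTraceState.canonExp_word (hτ : IsTraceState τ) (hB : wStar B ≤ B) (hP : B ≤ P)
    (hfree : ∀ l, IsWord (condExp τ B) P Q l → l ≠ [] → condExp τ B (l.map Prod.snd).prod = 0)
    {l : List (Bool × Elt M)} (hl : IsWord (condExp τ B) P Q l) (hc : ∃ c, (false, c) ∈ l) :
    canonExp τ P (l.map Prod.snd).prod = 0 := by
  have hE := hτ.isCondExp_canonExp P
  have hEB := hτ.isCondExp_condExp hB
  refine hτ.eq_of_forall_mul (hE.mem _) (zero_mem (wStar P)) fun a ha => ?_
  rw [← hE.mul_right a ha, hE.trace, zero_mul, map_zero]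
  refine hτ.mul_eq_zero_of_mem_wStar (fun y hy => ?_) ha
  rw [← hEB.trace, hEB.isBimodProj.word_mul_eq_zero hP hfree hl hc hy, map_zero]

theorem IsTraceState.canonExp_mem (hτ : IsTraceState τ) (hB : wStar B ≤ B) (hP : B ≤ P)
    (hQ : B ≤ Q)
    (hfree : ∀ l, IsWord (condExp τ B) P Q l → l ≠ [] → condExp τ B (l.map Prod.snd).prod = 0)
    {x : Elt M} (hx : x ∈ P ⊔ Q) : canonExp τ P x ∈ P := by
  have h : Submodule.span ℂ ((P : Set (Elt M)) ∪ {w | ∃ l, IsWord (condExp τ B) P Q l ∧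
      (∃ c, (false, c) ∈ l) ∧ w = (l.map Prod.snd).prod}) ≤
      P.toSubalgebra.toSubmodule.comap (canonExp τ P) := by
    rw [Submodule.span_le]
    rintro w (hw | ⟨l, hl, hc, rfl⟩)
    · change canonExp τ P w ∈ P
      rwa [(hτ.isCondExp_canonExp P).eq_self w (le_wStar P hw)]
    · change canonExp τ P _ ∈ P
      rw [hτ.canonExp_word hB hP hfree hl hc]
      exact zero_mem P
  exact h ((hτ.isCondExp_condExp hB).isBimodProj.mem_span_word hP hQ hx)

/-- If `P` and `Q` are free over `B`, then `E_P` intertwines the derivations of `P ∨ Q` which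
annihilate `Q` and map `P` to `P ⊗_S P`. -/
theorem IsTraceState.expTensor_derivation (hτ : IsTraceState τ) (hB : wStar B ≤ B) (hP : B ≤ P)
    (hQ : B ≤ Q)
    (hfree : ∀ l, IsWord (condExp τ B) P Q l → l ≠ [] → condExp τ B (l.map Prod.snd).prod = 0)
    (hSP : S ≤ P) (hPN : P ≤ N) (hQN : Q ≤ N) (hN : N ≤ P ⊔ Q)
    (hE : ∀ x ∈ N, canonExp τ P x ∈ P)
    {D : N →ₗ[ℂ] AmalgTensor S N} (hD : IsDerivation D)
    (hDQ : ∀ x : N, (x : Elt M) ∈ Q → D x = 0)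
    (hDP : ∀ x : P, D (StarSubalgebra.inclusion hPN x) ∈ LinearMap.range (tensorIncl hSP hPN))
    (x : N) : tensorIncl hSP hPN (expTensor τ hSP hE (D x)) =
      D ⟨canonExp τ P x, hPN (hE x x.2)⟩ := by
  have hEP := hτ.isCondExp_canonExp P
  exact hD.tensorMap_comp (hτ.isCondExp_condExp hB).isBimodProj hP hQ hSP hPN hQN hN
    (fun p => Subtype.ext (hEP.eq_self _ (le_wStar P p.2)))
    (fun p x => Subtype.ext (hEP.mul_left _ (le_wStar P p.2) _))
    (fun p x => Subtype.ext (hEP.mul_right _ (le_wStar P p.2) _))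
    (fun l hl hc x hx => Subtype.ext (by
      change canonExp τ P x = 0
      rw [hx]
      exact hτ.canonExp_word hB hP hfree hl hc)) hDQ hDP x

end Tracial

/-! ### Liberation and unitary derivations -/

section Algebraic

variable {R : Type u} [Ring R] [StarRing R] [Algebra ℂ R] [StarModule ℂ R]
variable {S A B Q : StarSubalgebra ℂ R}

theorem coe_inclusion {P N : StarSubalgebra ℂ R} (h : P ≤ N) (x : P) :
    ((StarSubalgebra.inclusion h x : N) : R) = x := rfl

theorem inclusion_mk {P N : StarSubalgebra ℂ R} (h : P ≤ N) (x : N) (hx : (x : R) ∈ P) :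
    StarSubalgebra.inclusion h ⟨x, hx⟩ = x := rfl

theorem mk_eq_inclusion {P N : StarSubalgebra ℂ R} (h : P ≤ N) (x : R) (hx : x ∈ P) :
    (⟨x, h hx⟩ : N) = StarSubalgebra.inclusion h ⟨x, hx⟩ := rfl

theorem inclusion_mem {P N K : StarSubalgebra ℂ R} (h : P ≤ N) (x : P) (hx : (x : R) ∈ K) :
    ((StarSubalgebra.inclusion h x : N) : R) ∈ K := hx

/-- The map `a ↦ a ⊗ 1 - 1 ⊗ a` from `P` to `N ⊗_S N`. -/
def commutatorMap (S : StarSubalgebra ℂ R) {P N : StarSubalgebra ℂ R} (hPN : P ≤ N) :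
    P →ₗ[ℂ] AmalgTensor S N :=
  ((tmkHom S N).flip 1 - tmkHom S N 1) ∘ₗ (StarSubalgebra.inclusion hPN).toAlgHom.toLinearMap

theorem commutatorMap_apply {P N : StarSubalgebra ℂ R} (hPN : P ≤ N) (a : P) :
    commutatorMap S hPN a = tmk S (StarSubalgebra.inclusion hPN a) 1 -
      tmk S 1 (StarSubalgebra.inclusion hPN a) := rfl

/-- The commutator with `1 ⊗ 1` on `A` and zero on `Q` agree on `S`, because `s ⊗ 1 = 1 ⊗ s` for `s
∈ S`. -/
theorem AlgFreeOver.exists_liberationDer (h : AlgFreeOver S A Q) :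
    ∃ δ, IsLiberationDer S A Q δ := by
  obtain ⟨D, hD, h₁, h₂⟩ := h.exists_derivation (commutatorMap S le_sup_left) 0
    (fun a b => by
      rw [commutatorMap_apply, commutatorMap_apply, commutatorMap_apply, map_sub, map_sub,
        lact_tmk, lact_tmk, ract_tmk, ract_tmk, _root_.map_mul, mul_one, one_mul]
      abel)
    (fun a b => by simp)
    (fun s h₁ h₂ hs => by
      have := tmk_balanced (S := S) (1 : ↥(A ⊔ Q)) 1
        (StarSubalgebra.inclusion le_sup_left ⟨s, h₁⟩) (inclusion_mem _ _ hs)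
      rw [one_mul, mul_one] at this
      rw [commutatorMap_apply, this, sub_self, LinearMap.zero_apply])
  refine ⟨D, hD, fun a ha => ?_, fun a ha => ?_⟩
  · have := h₁ ⟨a, ha⟩
    rwa [commutatorMap_apply, inclusion_mk] at this
  · have := h₂ ⟨a, ha⟩
    rwa [inclusion_mk] at this

theorem IsLiberationDer.exists_restrict {δ : ↥(A ⊔ Q) →ₗ[ℂ] AmalgTensor S (A ⊔ Q)}
    (h : IsLiberationDer S A Q δ) (hSP : S ≤ A ⊔ B) (hBQ : B ≤ Q) (hPN : A ⊔ B ≤ A ⊔ Q)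
    (hinj : Function.Injective (tensorIncl hSP hPN)) :
    ∃ δ', IsLiberationDer S A B δ' ∧
      ∀ x, tensorIncl hSP hPN (δ' x) = δ (StarSubalgebra.inclusion hPN x) := by
  have hA : ∀ x : ↥(A ⊔ B), (x : R) ∈ A →
      tensorIncl hSP hPN (tmk S x 1 - tmk S 1 x) = δ (StarSubalgebra.inclusion hPN x) := by
    intro x hx
    rw [h.2.1 _ (inclusion_mem hPN x hx), map_sub, tensorIncl_tmk, tensorIncl_tmk,
      _root_.map_one]
  have hB : ∀ x : ↥(A ⊔ B), (x : R) ∈ B → δ (StarSubalgebra.inclusion hPN x) = 0 :=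
    fun x hx => h.2.2 _ (inclusion_mem hPN x (hBQ hx))
  obtain ⟨d, hd, hdδ⟩ := h.1.exists_restrict hSP hPN hinj (fun x => by
    refine sup_induction (p := fun x => δ (StarSubalgebra.inclusion hPN x) ∈
      LinearMap.range (tensorIncl hSP hPN)) (fun x hx => ⟨_, hA x hx⟩) (fun x hx => ?_)
      (fun x y hx hy => ?_) (fun x y hx hy => h.1.mul_mem_range hSP hPN x y hx hy) x
    · rw [hB x hx]
      exact zero_mem _
    · rw [map_add, map_add]
      exact add_mem hx hy)
  refine ⟨d, ⟨hd, fun x hx => hinj ?_, fun x hx => hinj ?_⟩, hdδ⟩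
  · rw [hdδ, hA x hx]
  · rw [hdδ, hB x hx, map_zero]

/-- The derivation `d_{U:S;S}`, pushed into the larger tensor product, is glued with zero on `A`;
both vanish on `S`. -/
theorem UnitaryAlgFreeOver.exists_derivation {U : R} (h : UnitaryAlgFreeOver S U A) :
    ∃ D : ↥(adjoinU S U ⊔ A) →ₗ[ℂ] AmalgTensor S (adjoinU S U ⊔ A), IsDerivation D ∧
      (∀ u : ↥(adjoinU S U ⊔ A), (u : R) = U →
        D u = tmk S 1 u ∧ D (star u) = - tmk S (star u) 1) ∧
      ∀ a : ↥(adjoinU S U ⊔ A), (a : R) ∈ A → D a = 0 := by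
  obtain ⟨hfree, d, hd, hdU, hdS⟩ := h
  have hSP : S ≤ adjoinU S U := le_sup_left
  have hPN : adjoinU S U ≤ adjoinU S U ⊔ A := le_sup_left
  obtain ⟨D, hD, h₁, h₂⟩ := hfree.exists_derivation (tensorIncl hSP hPN ∘ₗ d) 0
    (fun a b => by
      rw [LinearMap.comp_apply, LinearMap.comp_apply, LinearMap.comp_apply, hd, map_add,
        tensorIncl_lact, tensorIncl_ract])
    (fun a b => by simp)
    (fun s h₁ h₂ hs => by
      rw [LinearMap.comp_apply, hdS ⟨s, h₁⟩ hs, map_zero, LinearMap.zero_apply])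
  have hUS : U ∈ adjoinU S U :=
    StarSubalgebra.mem_sup_right (StarAlgebra.subset_adjoin ℂ _ (Set.mem_singleton U))
  refine ⟨D, hD, fun u hu => ?_, fun a ha => by
    have := h₂ ⟨a, ha⟩
    rwa [inclusion_mk] at this⟩
  obtain ⟨u, rfl⟩ : ∃ u' : ↥(adjoinU S U), u = StarSubalgebra.inclusion hPN u' :=
    ⟨⟨u, by rw [hu]; exact hUS⟩, (inclusion_mk hPN u _).symm⟩
  rw [coe_inclusion] at hu
  obtain ⟨e₁, e₂⟩ := hdU u hu
  rw [← map_star, h₁ u, h₁ (star u), LinearMap.comp_apply, LinearMap.comp_apply, e₁, e₂, map_neg,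
    tensorIncl_tmk, tensorIncl_tmk, _root_.map_one]
  exact ⟨rfl, rfl⟩

/-- A derivation `D` with `D(U) = 1 ⊗ U`, `D(U*) = -U* ⊗ 1` which annihilates `A` restricts to
`d_{UV : B ; S}` for `V ∈ A` and `B ⊆ A`. -/
theorem IsDerivation.exists_unitaryDer {N : StarSubalgebra ℂ R} {U V W : R}
    {D : N →ₗ[ℂ] AmalgTensor S N} (hD : IsDerivation D)
    (hDU : ∀ u : N, (u : R) = U → D u = tmk S 1 u ∧ D (star u) = - tmk S (star u) 1)
    (hDA : ∀ a : N, (a : R) ∈ A → D a = 0) (hAN : A ≤ N) (hUN : U ∈ N) (hV : V ∈ A) (hBA : B ≤ A)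
    (hW : W = U * V) (hSP : S ≤ adjoinU B W) (hPN : adjoinU B W ≤ N)
    (hinj : Function.Injective (tensorIncl hSP hPN)) :
    ∃ d, IsUnitaryDer S B W d ∧
      ∀ x, tensorIncl hSP hPN (d x) = D (StarSubalgebra.inclusion hPN x) := by
  let U' : N := ⟨U, hUN⟩
  let V' : N := ⟨V, hAN hV⟩
  obtain ⟨e₁, e₂⟩ := hDU U' rfl
  have hV₁ : D V' = 0 := hDA V' hV
  have hV₂ : D (star V') = 0 := hDA (star V') (star_mem (s := A) hV)
  have hW₁ : ∀ w : ↥(adjoinU B W), (w : R) = W →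
      tensorIncl hSP hPN (tmk S 1 w) = D (StarSubalgebra.inclusion hPN w) := by
    intro w hw
    -- As `D(V) = 0`, the Leibniz rule gives `D(U V) = D(U) · V = 1 ⊗ U V`.
    have : StarSubalgebra.inclusion hPN w = U' * V' :=
      Subtype.ext ((coe_inclusion hPN w).trans (hw.trans hW))
    rw [tensorIncl_tmk, this, hD, hV₁, map_zero, zero_add, e₁, ract_tmk, _root_.map_one]
  have hW₂ : ∀ w : ↥(adjoinU B W), (w : R) = W →
      tensorIncl hSP hPN (-tmk S (star w) 1) = D (StarSubalgebra.inclusion hPN (star w)) := by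
    intro w hw
    have : StarSubalgebra.inclusion hPN (star w) = star V' * star U' :=
      Subtype.ext ((coe_inclusion hPN (star w)).trans (by
        change star (w : R) = star V * star U
        rw [hw, hW, star_mul]))
    rw [map_neg, tensorIncl_tmk, this, hD, hV₂, map_zero, add_zero, e₂, map_neg, lact_tmk,
      _root_.map_one]
  have hB : ∀ x : ↥(adjoinU B W), (x : R) ∈ B → D (StarSubalgebra.inclusion hPN x) = 0 :=
    fun x hx => hDA _ (inclusion_mem hPN x (hBA hx))
  obtain ⟨d, hd, hdD⟩ := hD.exists_restrict hSP hPN hinj (fun x => by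
    refine adjoinU_induction (p := fun x => D (StarSubalgebra.inclusion hPN x) ∈
      LinearMap.range (tensorIncl hSP hPN)) (fun x hx => ?_)
      (fun w hw => ⟨⟨_, hW₁ w hw⟩, ⟨_, hW₂ w hw⟩⟩)
      (fun x y hx hy => ?_) (fun x y hx hy => hD.mul_mem_range hSP hPN x y hx hy) x
    · rw [hB x hx]
      exact zero_mem _
    · rw [map_add, map_add]
      exact add_mem hx hy)
  refine ⟨d, ⟨hd, fun w hw => ⟨hinj ?_, hinj ?_⟩, fun x hx => hinj ?_⟩, hdD⟩
  · rw [hdD, hW₁ w hw]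
  · rw [hdD, hW₂ w hw]
  · rw [hdD, hB x hx, map_zero]

end Algebraic

/-! ### Assembly of the three intertwining identities. -/

section Tracial

variable {H : Type u} [NormedAddCommGroup H] [InnerProductSpace ℂ H] [CompleteSpace H]
variable {M : VonNeumannAlgebra H} {τ : Elt M →ₗ[ℂ] ℂ} {S B A C P N N' : StarSubalgebra ℂ (Elt M)}

theorem expTensor_tensorIncl (hSP : S ≤ P) (hSN' : S ≤ N') (hN : N' ≤ N)
    (hE : ∀ x ∈ N, canonExp τ P x ∈ P) (hE' : ∀ x ∈ N', canonExp τ P x ∈ P)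
    (t : AmalgTensor S N') :
    expTensor τ hSP hE (tensorIncl hSN' hN t) = expTensor τ hSP hE' t :=
  LinearMap.congr_fun (f := expTensor τ hSP hE ∘ₗ tensorIncl hSN' hN) (g := expTensor τ hSP hE')
    (amalgTensor_hom_ext fun _ _ => rfl) t

theorem BFree.condExp_word (h : BFree τ B A C) (l : List (Bool × Elt M))
    (hl : IsWord (condExp τ B) (A ⊔ B) (B ⊔ C) l) (hne : l ≠ []) :
    condExp τ B (l.map Prod.snd).prod = 0 :=
  h l hne hl.chain hl.mem

theorem IsTraceState.coalgebra_derivation (hτ : IsTraceState τ) (hB : wStar B ≤ B) (hSB : S ≤ B)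
    (hfree : BFree τ B A C) (hPN : A ⊔ B ≤ A ⊔ (B ⊔ C)) :
    ∃ hE : ∀ x ∈ A ⊔ (B ⊔ C), canonExp τ (A ⊔ B) x ∈ A ⊔ B,
      ∀ D : ↥(A ⊔ (B ⊔ C)) →ₗ[ℂ] AmalgTensor S (A ⊔ (B ⊔ C)), IsDerivation D →
        (∀ x : ↥(A ⊔ (B ⊔ C)), (x : Elt M) ∈ B ⊔ C → D x = 0) →
        (∀ x : ↥(A ⊔ (B ⊔ C)), (x : Elt M) ∈ A ⊔ B →
          D x ∈ LinearMap.range (tensorIncl (hSB.trans (le_sup_right : B ≤ A ⊔ B)) hPN)) →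
        ∀ x : ↥(A ⊔ (B ⊔ C)),
          tensorIncl (hSB.trans (le_sup_right : B ≤ A ⊔ B)) hPN
            (expTensor τ (hSB.trans (le_sup_right : B ≤ A ⊔ B)) hE (D x)) =
          D ⟨canonExp τ (A ⊔ B) x, hPN (hE x x.2)⟩ := by
  have hP : B ≤ A ⊔ B := le_sup_right
  have hQ : B ≤ B ⊔ C := le_sup_left
  have hN : A ⊔ (B ⊔ C) ≤ (A ⊔ B) ⊔ (B ⊔ C) := sup_le_sup_right le_sup_left _
  refine ⟨fun x hx => hτ.canonExp_mem hB hP hQ hfree.condExp_word (hN hx),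
    fun D hD hDQ hDP x => ?_⟩
  exact hτ.expTensor_derivation hB hP hQ hfree.condExp_word (hSB.trans hP) hPN le_sup_right hN _
    hD hDQ (fun x => hDP _ (inclusion_mem hPN x x.2)) x

theorem mem_range_of_restrict {hSP : S ≤ P} {hPN : P ≤ N} {D : N →ₗ[ℂ] AmalgTensor S N}
    {d : P →ₗ[ℂ] AmalgTensor S P}
    (hd : ∀ x, tensorIncl hSP hPN (d x) = D (StarSubalgebra.inclusion hPN x))
    (x : N) (hx : (x : Elt M) ∈ P) : D x ∈ LinearMap.range (tensorIncl hSP hPN) :=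
  ⟨d ⟨x, hx⟩, hd ⟨x, hx⟩⟩

theorem expTensor_restrict {hSP : S ≤ P} {hPN : P ≤ N} {D : N →ₗ[ℂ] AmalgTensor S N}
    {d : P →ₗ[ℂ] AmalgTensor S P} (hinj : Function.Injective (tensorIncl hSP hPN))
    (hd : ∀ x, tensorIncl hSP hPN (d x) = D (StarSubalgebra.inclusion hPN x))
    {hE : ∀ x ∈ N, canonExp τ P x ∈ P}
    (hD : ∀ x : N, tensorIncl hSP hPN (expTensor τ hSP hE (D x)) =
      D ⟨canonExp τ P x, hPN (hE x x.2)⟩) (x : N) :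
    expTensor τ hSP hE (D x) = d ⟨canonExp τ P x, hE x x.2⟩ :=
  hinj (by rw [hD, hd, mk_eq_inclusion hPN _ (hE x x.2)])

/-- Needed for `d_{UV:B;B₁}`, whose domain `N'` is not assumed to contain `P`: the two derivations
are compared through the ambient `D`. -/
theorem expTensor_restrict_restrict {hSP : S ≤ P} {hPN : P ≤ N} {hSN' : S ≤ N'} {hN : N' ≤ N}
    {D : N →ₗ[ℂ] AmalgTensor S N} {d : P →ₗ[ℂ] AmalgTensor S P}
    {d₁ : N' →ₗ[ℂ] AmalgTensor S N'} (hinj : Function.Injective (tensorIncl hSP hPN))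
    (hd : ∀ x, tensorIncl hSP hPN (d x) = D (StarSubalgebra.inclusion hPN x))
    (hd₁ : ∀ x, tensorIncl hSN' hN (d₁ x) = D (StarSubalgebra.inclusion hN x))
    {hE : ∀ x ∈ N, canonExp τ P x ∈ P} {hE' : ∀ x ∈ N', canonExp τ P x ∈ P}
    (hD : ∀ x : N, tensorIncl hSP hPN (expTensor τ hSP hE (D x)) =
      D ⟨canonExp τ P x, hPN (hE x x.2)⟩) (x : N') :
    expTensor τ hSP hE' (d₁ x) = d ⟨canonExp τ P x, hE' x x.2⟩ := by
  rw [← expTensor_tensorIncl hSP hSN' hN hE hE', hd₁, expTensor_restrict hinj hd hD]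
  rfl

theorem IsTraceState.coalgebra_liberation (hτ : IsTraceState τ) (hS : wStar S ≤ S)
    (hB : wStar B ≤ B) (hSB : S ≤ B) (hfree : BFree τ B A C) (halg : AlgFreeOver S A (B ⊔ C)) :
    (∃! δ, IsLiberationDer S A (B ⊔ C) δ) ∧ (∃! δ', IsLiberationDer S A B δ') ∧
    ∃ hE : ∀ x ∈ A ⊔ (B ⊔ C), canonExp τ (A ⊔ B) x ∈ A ⊔ B,
      ∀ δ δ', IsLiberationDer S A (B ⊔ C) δ → IsLiberationDer S A B δ' →
        ∀ x : ↥(A ⊔ (B ⊔ C)),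
          expTensor τ (hSB.trans (le_sup_right : B ≤ A ⊔ B)) hE (δ x) =
            δ' ⟨canonExp τ (A ⊔ B) x, hE x x.2⟩ := by
  have hSP : S ≤ A ⊔ B := hSB.trans le_sup_right
  have hPN : A ⊔ B ≤ A ⊔ (B ⊔ C) := sup_le_sup_left le_sup_left A
  have hinj := hτ.tensorIncl_injective hS hSP hPN
  have hex : ∃ δ, IsLiberationDer S A (B ⊔ C) δ := halg.exists_liberationDer
  refine hex.elim fun δ hδ => ?_
  have hex' : ∃ δ', IsLiberationDer S A B δ' ∧
      ∀ x, tensorIncl hSP hPN (δ' x) = δ (StarSubalgebra.inclusion hPN x) :=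
    hδ.exists_restrict hSP le_sup_left hPN hinj
  refine hex'.elim fun δ' hδ' => ?_
  have hcomm := hτ.coalgebra_derivation hB hSB hfree hPN
  refine ⟨⟨δ, hδ, fun δ₁ h₁ => h₁.unique hδ⟩, ⟨δ', hδ'.1, fun δ₁ h₁ => h₁.unique hδ'.1⟩,
    hcomm.elim fun hE hcomm => ⟨hE, ?_⟩⟩
  intro δ₁ δ₁' h₁ h₁' x
  rw [h₁.unique hδ, h₁'.unique hδ'.1]
  exact expTensor_restrict hinj hδ'.2 (hcomm δ hδ.1 hδ.2.2 (mem_range_of_restrict hδ'.2)) x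

theorem IsTraceState.coalgebra_unitary (hτ : IsTraceState τ) (hS : wStar S ≤ S)
    (hB : wStar B ≤ B) (hSB : S ≤ B) {U V : Elt M}
    (hfree : BFree τ B (StarAlgebra.adjoin ℂ {U}) (StarAlgebra.adjoin ℂ {V}))
    (halg : UnitaryAlgFreeOver S U (adjoinU B V)) :
    (∃! d, IsUnitaryDer S B (U * V) d) ∧ (∃! d', IsUnitaryDer S B U d') ∧
    (∀ x ∈ B ⊔ StarAlgebra.adjoin ℂ {U, V}, canonExp τ (adjoinU B U) x ∈ adjoinU B U) ∧
    ∃ hE : ∀ x ∈ adjoinU B (U * V), canonExp τ (adjoinU B U) x ∈ adjoinU B U,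
      ∀ d d', IsUnitaryDer S B (U * V) d → IsUnitaryDer S B U d' →
        ∀ x : ↥(adjoinU B (U * V)),
          expTensor τ (hSB.trans (le_sup_left : B ≤ adjoinU B U)) hE (d x) =
            d' ⟨canonExp τ (adjoinU B U) x, hE x x.2⟩ := by
  have hSP : S ≤ adjoinU B U := hSB.trans le_sup_left
  have hSR : S ≤ adjoinU B (U * V) := hSB.trans le_sup_left
  have hmem : ∀ (K : StarSubalgebra ℂ (Elt M)) (W : Elt M), W ∈ adjoinU K W := fun K W =>
    StarSubalgebra.mem_sup_right (StarAlgebra.subset_adjoin ℂ _ (Set.mem_singleton W))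
  have hle : ∀ {K L : StarSubalgebra ℂ (Elt M)} {W : Elt M}, K ≤ L → W ∈ L → adjoinU K W ≤ L :=
    fun hK hW => sup_le hK (StarAlgebra.adjoin_le (Set.singleton_subset_iff.mpr hW))
  have hQN : adjoinU B V ≤ adjoinU S U ⊔ adjoinU B V := le_sup_right
  have hBN : B ≤ adjoinU S U ⊔ adjoinU B V := le_sup_left.trans hQN
  have hUN : U ∈ adjoinU S U ⊔ adjoinU B V := StarSubalgebra.mem_sup_left (hmem S U)
  have hVN : V ∈ adjoinU S U ⊔ adjoinU B V := StarSubalgebra.mem_sup_right (hmem B V)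
  have hPN : adjoinU B U ≤ adjoinU S U ⊔ adjoinU B V := hle hBN hUN
  have hRN : adjoinU B (U * V) ≤ adjoinU S U ⊔ adjoinU B V := hle hBN (mul_mem hUN hVN)
  -- The ambient algebra comes from algebraic freeness over `S`, while freeness over `B` concerns
  -- `B⟨U, U*⟩` and `B⟨V, V*⟩`.
  have hN : adjoinU S U ⊔ adjoinU B V ≤ adjoinU B U ⊔ adjoinU B V :=
    sup_le_sup_right (sup_le_sup_right hSB _) _
  have hfree' : ∀ l, IsWord (condExp τ B) (adjoinU B U) (adjoinU B V) l → l ≠ [] →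
      condExp τ B (l.map Prod.snd).prod = 0 := by
    intro l hl hne
    rw [adjoinU, sup_comm] at hl
    exact hfree.condExp_word l hl hne
  have hE : ∀ x ∈ adjoinU B U ⊔ adjoinU B V, canonExp τ (adjoinU B U) x ∈ adjoinU B U :=
    fun x hx => hτ.canonExp_mem hB le_sup_left le_sup_left hfree' hx
  have hinjP := hτ.tensorIncl_injective hS hSP hPN
  have hinjR := hτ.tensorIncl_injective hS hSR hRN
  have hUV : StarAlgebra.adjoin ℂ {U, V} ≤ adjoinU B U ⊔ adjoinU B V :=
    StarAlgebra.adjoin_le (Set.insert_subset (StarSubalgebra.mem_sup_left (hmem B U))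
      (Set.singleton_subset_iff.mpr (StarSubalgebra.mem_sup_right (hmem B V))))
  have hBP : B ≤ adjoinU B U ⊔ adjoinU B V := (le_sup_left : B ≤ adjoinU B U).trans le_sup_left
  refine halg.exists_derivation.elim fun D hD => ?_
  -- `d_{U:B;S}` is the case `V = 1` of the restriction lemma.
  refine (hD.1.exists_unitaryDer hD.2.1 hD.2.2 hQN hUN (one_mem _) le_sup_left
    (mul_one U).symm hSP hPN hinjP).elim fun d' hd' => ?_
  refine (hD.1.exists_unitaryDer hD.2.1 hD.2.2 hQN hUN (hmem B V) le_sup_left rfl hSR hRN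
    hinjR).elim fun d hd => ?_
  refine ⟨⟨d, hd.1, fun d₁ h₁ => h₁.unique hd.1⟩, ⟨d', hd'.1, fun d₁ h₁ => h₁.unique hd'.1⟩,
    fun x hx => hE x (sup_le hBP hUV hx), fun x hx => hE x (hN (hRN hx)), ?_⟩
  intro d₁ d₁' h₁ h₁' x
  rw [h₁.unique hd.1, h₁'.unique hd'.1]
  exact expTensor_restrict_restrict hinjP hd'.2 hd.2
    (hτ.expTensor_derivation hB le_sup_left le_sup_left hfree' hSP hPN hQN hN
      (fun x hx => hE x (hN hx)) hD.1 hD.2.2 fun x => ⟨_, hd'.2 x⟩) x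

end Tracial

end FreeCoalg

end

theorem mainTheorem5 {H : Type*} [NormedAddCommGroup H] [InnerProductSpace ℂ H] [CompleteSpace H]
    (M : VonNeumannAlgebra H) (τ : Elt M →ₗ[ℂ] ℂ) (hτ : IsTraceState τ)
    (B₁ B : StarSubalgebra ℂ (Elt M)) (hB₁ : IsWStar B₁) (hB : IsWStar B) (hle : B₁ ≤ B) :
    -- the conditional expectation is a coalgebra morphism for general `D`
    (∀ A C : StarSubalgebra ℂ (Elt M), BFree τ B A C →
      ∀ D : ↥(A ⊔ (B ⊔ C)) →ₗ[ℂ] AmalgTensor B₁ (A ⊔ (B ⊔ C)), IsDerivation D →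
        (∀ x : ↥(A ⊔ (B ⊔ C)), (x : Elt M) ∈ B ⊔ C → D x = 0) →
        (∀ x : ↥(A ⊔ (B ⊔ C)), (x : Elt M) ∈ A ⊔ B →
          D x ∈ LinearMap.range (tensorIncl (S := B₁) (hle.trans (le_sup_right : B ≤ A ⊔ B))
            (sup_le_sup_left (le_sup_left : B ≤ B ⊔ C) A))) →
        ∃ hE : ∀ x ∈ A ⊔ (B ⊔ C), canonExp τ (A ⊔ B) x ∈ A ⊔ B,
          ∀ x : ↥(A ⊔ (B ⊔ C)),
            tensorIncl (S := B₁) (hle.trans (le_sup_right : B ≤ A ⊔ B))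
                (sup_le_sup_left (le_sup_left : B ≤ B ⊔ C) A)
                (expTensor τ (hle.trans (le_sup_right : B ≤ A ⊔ B)) hE (D x)) =
              D ⟨canonExp τ (A ⊔ B) x,
                sup_le_sup_left (le_sup_left : B ≤ B ⊔ C) A (hE x x.2)⟩) ∧
    -- the case of `δ_{A : B ∨ C; B₁}` and `δ_{A : B; B₁}`
    (∀ A C : StarSubalgebra ℂ (Elt M), BFree τ B A C → AlgFreeOver B₁ A (B ⊔ C) →
      (∃! δ, IsLiberationDer B₁ A (B ⊔ C) δ) ∧ (∃! δ', IsLiberationDer B₁ A B δ') ∧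
      ∃ hE : ∀ x ∈ A ⊔ (B ⊔ C), canonExp τ (A ⊔ B) x ∈ A ⊔ B,
        ∀ δ δ', IsLiberationDer B₁ A (B ⊔ C) δ → IsLiberationDer B₁ A B δ' →
          ∀ x : ↥(A ⊔ (B ⊔ C)),
            expTensor τ (hle.trans (le_sup_right : B ≤ A ⊔ B)) hE (δ x) =
              δ' ⟨canonExp τ (A ⊔ B) x, hE x x.2⟩) ∧
    -- the case of `d_{UV : B; B₁}` and `d_{U : B; B₁}`
    (∀ U V : Elt M, U ∈ unitary (Elt M) → V ∈ unitary (Elt M) →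
      BFree τ B (StarAlgebra.adjoin ℂ {U}) (StarAlgebra.adjoin ℂ {V}) →
      UnitaryAlgFreeOver B₁ U (adjoinU B V) →
      (∃! d, IsUnitaryDer B₁ B (U * V) d) ∧ (∃! d', IsUnitaryDer B₁ B U d') ∧
      (∀ x ∈ B ⊔ StarAlgebra.adjoin ℂ {U, V}, canonExp τ (adjoinU B U) x ∈ adjoinU B U) ∧
      ∃ hE : ∀ x ∈ adjoinU B (U * V), canonExp τ (adjoinU B U) x ∈ adjoinU B U,
        ∀ d d', IsUnitaryDer B₁ B (U * V) d → IsUnitaryDer B₁ B U d' →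
          ∀ x : ↥(adjoinU B (U * V)),
            expTensor τ (hle.trans (le_sup_left : B ≤ adjoinU B U)) hE (d x) =
              d' ⟨canonExp τ (adjoinU B U) x, hE x x.2⟩) := by
  have hS := hB₁.wStar_le
  have hBB := hB.wStar_le
  refine ⟨fun A C hfree D hD hDQ hDP => ?_, fun A C hfree halg => ?_, fun U V _ _ hfree halg => ?_⟩
  · exact (hτ.coalgebra_derivation hBB hle hfree (sup_le_sup_left le_sup_left A)).elim
      fun hE h => ⟨hE, h D hD hDQ hDP⟩
  · exact hτ.coalgebra_liberation hS hBB hle hfree halg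
  · exact hτ.coalgebra_unitary hS hBB hle hfree halg
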